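/- Fix $t>0$ and $\lambda>0$. For a positive integer $J$ let $\mathcal R_J=\mathbb Z^2\cap([-J,J]\times[0,J])$, $N_J=\#\mathcal R_J=(2J+1)(J+1)$, $O=(0,0)$ and $P_{t,J}=(-tJ^2,0)$. Let $\alpha_1\le\alpha_2\le\dots\le\alpha_{N_J}$ be the angles $\angle(P\,P_{t,J}\,O)$ (with vertex $P_{t,J}$), $P\in\mathcal R_J$, listed with multiplicity in increasing order, put $\Delta_{av}=\alpha_{N_J}/N_J$, and let $$G_{t,J}(\lambda)=\frac1{N_J}\,\#\{1\le j<N_J:\ \alpha_{j+1}-\alpha_j\ge\lambda\Delta_{av}\}.$$ For integers $k,r\ge 0$ and real $w>0$ and $x$, let $$R_{k,r,w}=\max\Big\{\frac{kt}{w^2}-\frac1w,\ \frac1w-\frac{(r+1)t}{w^2}\Big\},\qquad S_{k,r,w}=\min\Big\{\frac{(k+1)t}{w^2}-\frac1w,\ \frac1w-\frac{rt}{w^2}\Big\},\qquad y_w=\frac{\lambda t}{2w},$$ $$A_{k,r,w}(x)=\Big\{z\in[R_{k,r,w}+x,\ S_{k,r,w}+x]:\ \min_{-k\le j\le r,\ j\ne0}\{jz\}\ge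 y_w\Big\},$$ where $\{\cdot\}$ is the fractional part and the condition on the minimum is void if $k=r=0$, and let $$M^-_{k,r}=\max\Big\{\frac{\lambda t}2,\frac{(k+r)t}2\Big\},\qquad M^+_{k,r}=\min\Big\{1,\frac{(k+r+2)t}2\Big\},\qquad h=\Big\lfloor\frac2t\Big\rfloor.$$ Then the limit $G_t(\lambda)=\lim_{J\to\infty}G_{t,J}(\lambda)$ exists, and $$G_t(\lambda)=\frac12\sum_{\substack{0\le k,r\le h\\ M^-_{k,r}\le M^+_{k,r}}}\int_{M^-_{k,r}}^{M^+_{k,r}}\int_0^1 w\,\mu\big(A_{k,r,w}(x)\big)\,dx\,dw,$$ where $\mu$ is the Lebesgue measure. -/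

import Mathlib

open scoped EuclideanGeometry Topology

noncomputable section

namespace MovingObserver

/-- The observer `P_{t,J} = (-tJ², 0)`. -/
def observer (t : ℝ) (J : ℕ) : EuclideanSpace ℝ (Fin 2) := !₂[-(t * (J : ℝ) ^ 2), 0]

/-- The lattice points of the rectangle `[-J, J] × [0, J]`. -/
def rect (J : ℕ) : Finset (ℤ × ℤ) :=
  Finset.Icc (-(J : ℤ)) (J : ℤ) ×ˢ Finset.Icc (0 : ℤ) (J : ℤ)

/-- The number `N_J` of lattice points of the rectangle. -/
def numPts (J : ℕ) : ℕ := (rect J).card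

/-- A lattice point as a point of the Euclidean plane. -/
def toPlane (P : ℤ × ℤ) : EuclideanSpace ℝ (Fin 2) := !₂[(P.1 : ℝ), (P.2 : ℝ)]

/-- The angle `∠ P P_{t,J} O`, with vertex at the observer and `O` the origin. -/
def viewAngle (t : ℝ) (J : ℕ) (P : ℤ × ℤ) : ℝ := ∠ (toPlane P) (observer t J) 0

/-- The `N_J` angles `∠ P P_{t,J} O`, repeated according to multiplicity, in increasing order. -/
def sortedAngles (t : ℝ) (J : ℕ) : List ℝ :=
  ((rect J).val.map (viewAngle t J)).sort (· ≤ ·)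

/-- The `j`-th smallest angle `α_j`, for `1 ≤ j ≤ N_J` (the numbering starts at `1`). -/
def alpha (t : ℝ) (J j : ℕ) : ℝ := (sortedAngles t J).getD (j - 1) 0

/-- The average gap `Δ_av = α_max / N_J`, where `α_max = α_{N_J}`. -/
def avgGap (t : ℝ) (J : ℕ) : ℝ := alpha t J (numPts J) / (numPts J : ℝ)

/-- The gap distribution function
`G_{t,J}(λ) = #{1 ≤ j < N_J : α_{j+1} - α_j ≥ λ Δ_av} / N_J`. -/
def gapDist (t : ℝ) (J : ℕ) (lam : ℝ) : ℝ :=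
  (((Finset.Ico 1 (numPts J)).filter
    (fun j => lam * avgGap t J ≤ alpha t J (j + 1) - alpha t J j)).card : ℝ) / (numPts J : ℝ)

/-- `R_{k,r,w}`. -/
def R (t : ℝ) (k r : ℕ) (w : ℝ) : ℝ :=
  max ((k : ℝ) * t / w ^ 2 - 1 / w) (1 / w - ((r : ℝ) + 1) * t / w ^ 2)

/-- `S_{k,r,w}`. -/
def S (t : ℝ) (k r : ℕ) (w : ℝ) : ℝ :=
  min (((k : ℝ) + 1) * t / w ^ 2 - 1 / w) (1 / w - (r : ℝ) * t / w ^ 2)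

/-- `y_w = λt / (2w)`. -/
def y (t lam w : ℝ) : ℝ := lam * t / (2 * w)

/-- `A_{k,r,w}(x)`: the `z ∈ [R_{k,r,w} + x, S_{k,r,w} + x]` all of whose fractional parts `{jz}`,
`-k ≤ j ≤ r`, `j ≠ 0`, are at least `y_w` (no condition if there is no such `j`). -/
def A (t lam : ℝ) (k r : ℕ) (w x : ℝ) : Set ℝ :=
  {z : ℝ | z ∈ Set.Icc (R t k r w + x) (S t k r w + x) ∧
    ∀ j : ℤ, -(k : ℤ) ≤ j → j ≤ (r : ℤ) → j ≠ 0 → y t lam w ≤ Int.fract ((j : ℝ) * z)}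

/-- `M⁻_{k,r}`. -/
def Mminus (t lam : ℝ) (k r : ℕ) : ℝ := max (lam * t / 2) (((k : ℝ) + (r : ℝ)) * t / 2)

/-- `M⁺_{k,r}`. -/
def Mplus (t : ℝ) (k r : ℕ) : ℝ := min 1 (((k : ℝ) + (r : ℝ) + 2) * t / 2)

/-- The pairs `(k, r)` with `0 ≤ k, r ≤ h = ⌊2/t⌋` and `M⁻_{k,r} ≤ M⁺_{k,r}`. -/
def pairs (t lam : ℝ) : Finset (ℕ × ℕ) :=
  (Finset.range (⌊2 / t⌋₊ + 1) ×ˢ Finset.range (⌊2 / t⌋₊ + 1)).filter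
    (fun p => Mminus t lam p.1 p.2 ≤ Mplus t p.1 p.2)

end MovingObserver

end

open Filter MeasureTheory
open scoped ENNReal BoundedContinuousFunction EuclideanGeometry Topology

noncomputable section

namespace MovingObserver

/-! The gap after a lattice point is read off from three numbers attached to that point. Put `T =
tJ²` and, for `P = (a, b)`, `w = b/J`, `x = a/J` and `z = (T + a)/b` mod 1. For `Q = (a + m, b + j)`
the difference of the slopes seen from the observer is governed by the determinant `(b + j)(T + a) -
b(T + a + m) = b·s`, where `s = j(T + a)/b - m` is congruent to `jz` mod 1. In units of the average
gap the angle from `P` to `Q` is therefore asymptotically `2ws/t` (`exists_slopeDiff_bounds`,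
`tendsto_mul_avgGap`, `slopeDiff_eq_of_eq`). For bounded `s` the abscissa of `Q` is `J(xw + jt)/w +
O(1)`, so row `b + j` can contribute only if `|xw + jt| ≤ w`, up to a small error. Hence a gap of
length at least `λ` follows `P` essentially when `w > λt/2` (row `j = 0`) and `{jz} ≥ λt/(2w)` for
every visible `j ≠ 0`; the visible `j` are those in `[-k, r]`, with `k` and `r` the integer parts of
`(1 + x)w/t` and `(1 - x)w/t`.

The triples `(w, x, z)` become uniformly distributed in `[0,1] × [-1,1] × ℝ/ℤ`
(`tendsto_empiricalProb`). By characters this reduces to cancellation in the sum of `e(pw + nz)`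
along each column, `n ≠ 0`. Moving up one row multiplies the term by nearly `e(-nt/w²)`, a slowly
varying factor that equals 1 only on a null set of `w`, and summation by parts gives `o(J)`
uniformly over the columns (`eventually_norm_sum_phase_le`).

The gap condition is trapped between a closed set and an open set of triples depending on `ε`. The
portmanteau theorem, followed by `ε → 0`, identifies the limit as the measure of the union of the
`piece`s (`tendsto_gapDist`). At fixed `w` a piece is the product of the interval `(wR, wS)` in `x`
with a set of phases. Averaging that periodic set over translates of `[R, S]` turns its measure into
the stated integral (`limitMeasure_biUnion_piece`). -/

/-! ### Counting gaps of a sorted list by points -/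

/-- The values of `f` on `s`, sorted, are enumerated by a monotone composite `f ∘ e`. -/
lemma exists_equiv_sort_eq_ofFn {ι : Type*} (s : Finset ι) (f : ι → ℝ) :
    ∃ e : Fin s.card ≃ s, Monotone (fun i => f (e i)) ∧
      (s.val.map f).sort (· ≤ ·) = List.ofFn (fun i => f (e i)) := by
  let e₀ : Fin s.card ≃ s := s.equivFin.symm
  let e : Fin s.card ≃ s := (Tuple.sort (fun i => f (e₀ i))).trans e₀
  have hm : Monotone (fun i => f (e i)) := Tuple.monotone_sort (fun i => f (e₀ i))
  refine ⟨e, hm, ?_⟩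
  refine List.Perm.eq_of_pairwise (le := (· ≤ ·)) (fun a b _ _ h1 h2 => le_antisymm h1 h2)
    (Multiset.pairwise_sort _ _) ?_ ?_
  · exact (List.sortedLE_ofFn_iff.2 hm).pairwise
  · rw [← Multiset.coe_eq_coe, Multiset.sort_eq]
    rw [List.ofFn_eq_map, ← Multiset.map_coe]
    have h1 : ((List.finRange s.card : List _) : Multiset (Fin s.card))
        = (Finset.univ : Finset (Fin s.card)).val := rfl
    rw [h1]
    have h2 : (Finset.univ : Finset (Fin s.card)).val.map (fun i => (e i : ι)) = s.val := by
      have h3 : (Finset.univ : Finset (Fin s.card)).map (e.toEmbedding.trans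
          (Function.Embedding.subtype _)) = s := by
        ext x
        simp only [Finset.mem_map, Finset.mem_univ, true_and, Function.Embedding.trans_apply,
          Equiv.coe_toEmbedding, Function.Embedding.subtype_apply]
        constructor
        · rintro ⟨i, rfl⟩; exact (e i).2
        · intro hx; exact ⟨e.symm ⟨x, hx⟩, by simp⟩
      conv_rhs => rw [← h3]
      rfl
    rw [← h2, Multiset.map_map]
    rfl

/-- The sorted values of `f` on `s`, as a monotone enumeration of `s` by natural numbers. -/
lemma exists_enum_sort {ι : Type*} (s : Finset ι) (hs : s.Nonempty) (f : ι → ℝ) :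
    ∃ E : ℕ → ι, (∀ i < s.card, E i ∈ s) ∧ (∀ P ∈ s, ∃ i < s.card, E i = P) ∧
      (∀ i j, i < s.card → j < s.card → E i = E j → i = j) ∧
      (∀ i j, i ≤ j → j < s.card → f (E i) ≤ f (E j)) ∧
      ∀ i < s.card, ((s.val.map f).sort (· ≤ ·)).getD i 0 = f (E i) := by
  obtain ⟨e, hm, hl⟩ := exists_equiv_sort_eq_ofFn s f
  have hc : 0 < s.card := Finset.card_pos.2 hs
  have hE : ∀ i (h : i < s.card),
      (fun i => if h : i < s.card then (e ⟨i, h⟩ : ι) else (e ⟨0, hc⟩ : ι)) i = e ⟨i, h⟩ := by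
    intro i h; simp [h]
  refine ⟨fun i => if h : i < s.card then (e ⟨i, h⟩ : ι) else (e ⟨0, hc⟩ : ι), ?_, ?_, ?_, ?_, ?_⟩
  · intro i h; rw [hE i h]; exact (e _).2
  · intro P hP
    refine ⟨e.symm ⟨P, hP⟩, (e.symm ⟨P, hP⟩).2, ?_⟩
    rw [hE _ (e.symm ⟨P, hP⟩).2]; simp
  · intro i j hi hj h
    rw [hE i hi, hE j hj] at h
    simpa using e.injective (Subtype.ext h)
  · intro i j hij hj
    rw [hE i (hij.trans_lt hj), hE j hj]
    exact hm (Fin.mk_le_mk.2 hij)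
  · intro i h
    rw [hE i h, hl]; simp [List.getD, h]

-- The gap with number `j` is charged to the point at its left end, which has 0-based index `j - 1`;
-- no value lies strictly inside the gap. Tied points can all satisfy the condition on the right, so
-- only an upper bound is claimed.
open Classical in
lemma card_gaps_le {ι : Type*} (s : Finset ι) (f : ι → ℝ) {δ : ℝ} (hδ : 0 < δ) :
    ((Finset.Ico 1 s.card).filter (fun j => δ ≤ ((s.val.map f).sort (· ≤ ·)).getD (j + 1 - 1) 0
      - ((s.val.map f).sort (· ≤ ·)).getD (j - 1) 0)).card ≤
    (s.filter (fun P => ∀ Q ∈ s, ¬ (f P < f Q ∧ f Q < f P + δ))).card := by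
  rcases s.eq_empty_or_nonempty with rfl | hs
  · simp
  obtain ⟨E, hEs, hsurj, -, hmono, hget⟩ := exists_enum_sort s hs f
  have key : ∀ j, j ∈ (Finset.Ico 1 s.card).filter (fun j => δ ≤
      ((s.val.map f).sort (· ≤ ·)).getD (j + 1 - 1) 0
      - ((s.val.map f).sort (· ≤ ·)).getD (j - 1) 0) →
      1 ≤ j ∧ j < s.card ∧ f (E (j - 1)) + δ ≤ f (E j) := by
    intro j hj
    rw [Finset.mem_filter, Finset.mem_Ico, hget (j + 1 - 1) (by simp at hj ⊢; omega),
      hget (j - 1) (by simp at hj ⊢; omega)] at hj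
    refine ⟨hj.1.1, hj.1.2, ?_⟩
    have := hj.2
    simp only [Nat.add_sub_cancel] at this
    linarith
  refine Finset.card_le_card_of_injOn (fun j => E (j - 1)) ?_ ?_
  · intro j hj
    obtain ⟨h1, h2, h3⟩ := key j hj
    simp only [Finset.coe_filter, Set.mem_ofPred_eq]
    refine ⟨hEs _ (by omega), ?_⟩
    rintro Q hQ ⟨h4, h5⟩
    obtain ⟨i, hi, rfl⟩ := hsurj Q hQ
    rcases le_or_gt j i with h | h
    · linarith [hmono j i h hi]
    · linarith [hmono i (j - 1) (by omega) (by omega)]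
  -- Injectivity follows from monotonicity alone: the value jumps by `δ > 0` at `i`, so it cannot
  -- recur at a later index.
  · have aux : ∀ i j, i < j → 1 ≤ i → j < s.card → f (E (i - 1)) + δ ≤ f (E i) →
        E (i - 1) = E (j - 1) → False := by
      intro i j hij _ hj hd h
      have := hmono i (j - 1) (by omega) (by omega)
      rw [h] at hd; linarith
    intro i hi j hj h
    obtain ⟨h1, h2, h3⟩ := key i hi
    obtain ⟨h4, h5, h6⟩ := key j hj
    rcases lt_trichotomy i j with hij | hij | hij
    · exact (aux i j hij h1 h5 h3 h).elim
    · exact hij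
    · exact (aux j i hij h4 h2 h6 h.symm).elim

-- A point with no other value in the half-open window, ties included, is the left end of a long
-- gap, unless it is the last point. The last point has no successor, which costs the `+ 1`.
open Classical in
lemma le_card_gaps_add_one {ι : Type*} [DecidableEq ι] (s : Finset ι) (f : ι → ℝ) (δ : ℝ) :
    (s.filter (fun P => ∀ Q ∈ s, Q ≠ P → ¬ (f P ≤ f Q ∧ f Q < f P + δ))).card ≤
    ((Finset.Ico 1 s.card).filter (fun j => δ ≤ ((s.val.map f).sort (· ≤ ·)).getD (j + 1 - 1) 0
      - ((s.val.map f).sort (· ≤ ·)).getD (j - 1) 0)).card + 1 := by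
  rcases s.eq_empty_or_nonempty with rfl | hs
  · simp
  obtain ⟨E, hEs, hsurj, hinj, hmono, hget⟩ := exists_enum_sort s hs f
  choose! g hg1 hg2 using hsurj
  refine le_trans (Finset.card_le_card_of_injOn (fun P => g P + 1) (t := insert s.card
    ((Finset.Ico 1 s.card).filter (fun j => δ ≤ ((s.val.map f).sort (· ≤ ·)).getD (j + 1 - 1) 0
      - ((s.val.map f).sort (· ≤ ·)).getD (j - 1) 0))) ?_ ?_) (Finset.card_insert_le _ _)
  · intro P hP
    simp only [Finset.coe_filter, Set.mem_ofPred_eq] at hP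
    obtain ⟨hP, hPQ⟩ := hP
    rw [Finset.coe_insert, Set.mem_insert_iff]
    by_cases h : g P + 1 = s.card
    · exact Or.inl h
    · right
      have h1 := hg1 P hP
      have h2 : g P + 1 < s.card := by omega
      rw [Finset.mem_coe, Finset.mem_filter, Finset.mem_Ico, hget _ (by simpa using h2),
        hget _ (by simpa using h1)]
      refine ⟨⟨Nat.succ_le_succ (Nat.zero_le _), h2⟩, ?_⟩
      simp only [Nat.add_sub_cancel]
      rw [hg2 P hP]
      by_contra hlt
      refine hPQ (E (g P + 1)) (hEs _ h2) ?_ ⟨?_, by linarith⟩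
      · intro h3
        have := hinj _ _ h2 h1 (h3.trans (hg2 P hP).symm)
        omega
      · conv_lhs => rw [← hg2 P hP]
        exact hmono _ _ (by omega) h2
  · intro P hP Q hQ h
    simp only [Finset.coe_filter, Set.mem_ofPred_eq] at hP hQ
    have h : g P = g Q := by simpa using h
    rw [← hg2 P hP.1, ← hg2 Q hQ.1, h]

/-- The largest of the sorted values. -/
lemma getD_sort_eq_of_forall_le {ι : Type*} (s : Finset ι) (f : ι → ℝ) {P : ι} (hP : P ∈ s)
    (h : ∀ Q ∈ s, f Q ≤ f P) : ((s.val.map f).sort (· ≤ ·)).getD (s.card - 1) 0 = f P := by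
  obtain ⟨E, hEs, hsurj, hinj, hmono, hget⟩ := exists_enum_sort s ⟨P, hP⟩ f
  have hc : 0 < s.card := Finset.card_pos.2 ⟨P, hP⟩
  rw [hget _ (by omega)]
  obtain ⟨i, hi, rfl⟩ := hsurj P hP
  exact le_antisymm (h _ (hEs _ (by omega))) (hmono _ _ (by omega) (by omega))

/-! ### Angles, slopes and the average gap -/

lemma mem_rect {J : ℕ} {P : ℤ × ℤ} :
    P ∈ rect J ↔ (-(J : ℤ) ≤ P.1 ∧ P.1 ≤ J) ∧ 0 ≤ P.2 ∧ P.2 ≤ J := by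
  simp [rect, Finset.mem_product]

lemma cast_mem_rect {J : ℕ} {P : ℤ × ℤ} (h : P ∈ rect J) :
    (-(J : ℝ) ≤ P.1 ∧ (P.1 : ℝ) ≤ J) ∧ (0 : ℝ) ≤ P.2 ∧ (P.2 : ℝ) ≤ J := by
  rw [mem_rect] at h
  exact_mod_cast h

lemma numPts_eq (J : ℕ) : numPts J = (2 * J + 1) * (J + 1) := by
  rw [numPts, rect, Finset.card_product, Int.card_Icc, Int.card_Icc]
  congr 1; omega

lemma viewAngle_eq_arctan {t : ℝ} {J : ℕ} {P : ℤ × ℤ} (hT : 0 < t * (J : ℝ) ^ 2)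
    (h0 : (0 : ℝ) ≤ P.2) (h : 0 < t * (J : ℝ) ^ 2 + P.1) :
    viewAngle t J P = Real.arctan (P.2 / (t * (J : ℝ) ^ 2 + P.1)) := by
  have h1 : 0 ≤ (P.2 : ℝ) / (t * (J : ℝ) ^ 2 + P.1) := div_nonneg h0 h.le
  rw [viewAngle, EuclideanGeometry.angle, InnerProductGeometry.angle, Real.arctan_eq_arccos h1]
  congr 1
  have e1 : toPlane P -ᵥ observer t J = !₂[t * (J : ℝ) ^ 2 + P.1, (P.2 : ℝ)] := by
    ext i; fin_cases i <;> simp [toPlane, observer, add_comm]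
  have e2 : (0 : EuclideanSpace ℝ (Fin 2)) -ᵥ observer t J = !₂[t * (J : ℝ) ^ 2, 0] := by
    ext i; fin_cases i <;> simp [observer]
  rw [e1, e2, EuclideanSpace.norm_eq, EuclideanSpace.norm_eq]
  generalize t * (J : ℝ) ^ 2 = T at *
  simp only [PiLp.inner_apply, Fin.sum_univ_two, Real.norm_eq_abs, sq_abs]
  have e3 : √(1 + ((P.2 : ℝ) / (T + P.1)) ^ 2) = √((T + P.1) ^ 2 + (P.2 : ℝ) ^ 2) / (T + P.1) := by
    rw [eq_div_iff h.ne', ← Real.sqrt_sq h.le, ← Real.sqrt_mul (by positivity)]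
    rw [Real.sqrt_sq h.le]
    congr 1
    field_simp
  have e4 : 0 < √((T + P.1) ^ 2 + (P.2 : ℝ) ^ 2) := by positivity
  rw [e3]
  simp [Real.sqrt_sq hT.le]
  field_simp

lemma arctan_sub_arctan_le {s s' : ℝ} (h : s ≤ s') :
    Real.arctan s' - Real.arctan s ≤ s' - s := by
  have := Convex.image_sub_le_mul_sub_of_deriv_le (D := Set.univ) convex_univ (f := Real.arctan)
    (C := 1) Real.continuous_arctan.continuousOn Real.differentiable_arctan.differentiableOn
    (fun x _ => by
      rw [Real.deriv_arctan, div_le_one (by positivity)]; nlinarith [sq_nonneg x])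
    s (Set.mem_univ _) s' (Set.mem_univ _) h
  linarith

lemma le_arctan_sub_arctan {s s' σ : ℝ} (h0 : 0 ≤ s) (h : s ≤ s') (hσ : s' ≤ σ) :
    (s' - s) * (1 + σ ^ 2)⁻¹ ≤ Real.arctan s' - Real.arctan s := by
  have := Convex.mul_sub_le_image_sub_of_le_deriv (D := Set.Icc s s') (convex_Icc _ _)
    (f := Real.arctan) (C := (1 + σ ^ 2)⁻¹) Real.continuous_arctan.continuousOn
    Real.differentiable_arctan.differentiableOn
    (fun x hx => by
      rw [interior_Icc] at hx
      have hx1 := hx.1; have hx2 := hx.2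
      rw [Real.deriv_arctan]
      change (1 + σ ^ 2)⁻¹ ≤ 1 / (1 + x ^ 2)
      rw [one_div]
      gcongr
      all_goals linarith)
    s (Set.left_mem_Icc.2 h) s' (Set.right_mem_Icc.2 h) h
  linarith

/-- The rescaled difference of the slopes of two lattice points seen from the observer, up to
the product of the abscissas. -/
def slopeDiff (t : ℝ) (J : ℕ) (P Q : ℤ × ℤ) : ℝ :=
  2 * (Q.2 * (t * (J : ℝ) ^ 2 + P.1) - P.2 * (t * (J : ℝ) ^ 2 + Q.1)) / (t * J)

lemma slopeDiff_swap (t : ℝ) (J : ℕ) (P Q : ℤ × ℤ) : slopeDiff t J Q P = -slopeDiff t J P Q := by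
  unfold slopeDiff; ring

lemma eventually_two_lt_mul {t : ℝ} (ht : 0 < t) : ∀ᶠ J : ℕ in atTop, 0 < J ∧ 2 < t * (J : ℝ) := by
  have h : Tendsto (fun J : ℕ => t * (J : ℝ)) atTop atTop :=
    tendsto_natCast_atTop_atTop.const_mul_atTop ht
  exact (eventually_gt_atTop 0).and (h.eventually_gt_atTop 2)

lemma tendsto_one_div_mul_natCast {t : ℝ} (ht : 0 < t) :
    Tendsto (fun J : ℕ => 1 / (t * (J : ℝ))) atTop (𝓝 0) := by
  have h : Tendsto (fun J : ℕ => t * (J : ℝ)) atTop atTop :=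
    tendsto_natCast_atTop_atTop.const_mul_atTop ht
  exact h.inv_tendsto_atTop.congr fun J => by simp

/-- With `u = 1/(tJ)`, all distances `T + a` lie between `(1 - u)T` and `(1 + u)T`, and all slopes
are at most `u/(1 - u)`, where the derivative of `arctan` is close to 1. The constants are therefore
uniform over all pairs of points. -/
lemma exists_slopeDiff_bounds {t : ℝ} (ht : 0 < t) :
    ∃ c₁ c₂ : ℕ → ℝ, Tendsto c₁ atTop (𝓝 1) ∧ Tendsto c₂ atTop (𝓝 1) ∧
      ∀ᶠ J in atTop, 0 < c₁ J ∧ 0 < c₂ J ∧ ∀ P ∈ rect J, ∀ Q ∈ rect J, 0 ≤ slopeDiff t J P Q →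
        c₁ J * slopeDiff t J P Q ≤ 2 * t * (J : ℝ) ^ 3 * (viewAngle t J Q - viewAngle t J P) ∧
        2 * t * (J : ℝ) ^ 3 * (viewAngle t J Q - viewAngle t J P) ≤ c₂ J * slopeDiff t J P Q := by
  have h0 := tendsto_one_div_mul_natCast ht
  refine ⟨fun J => ((1 + 1 / (t * (J : ℝ))) ^ 2)⁻¹ *
      (1 + (1 / (t * (J : ℝ)) * (1 - 1 / (t * (J : ℝ)))⁻¹) ^ 2)⁻¹,
    fun J => ((1 - 1 / (t * (J : ℝ))) ^ 2)⁻¹, ?_, ?_, ?_⟩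
  · have : ContinuousAt (fun u : ℝ => ((1 + u) ^ 2)⁻¹ * (1 + (u * (1 - u)⁻¹) ^ 2)⁻¹) 0 := by
      have : (1 - (0 : ℝ)) ≠ 0 := by norm_num
      fun_prop (disch := simp)
    simpa [Function.comp_def] using this.tendsto.comp h0
  · have : ContinuousAt (fun u : ℝ => ((1 - u) ^ 2)⁻¹) 0 := by
      fun_prop (disch := simp)
    simpa [Function.comp_def] using this.tendsto.comp h0
  · filter_upwards [eventually_two_lt_mul ht] with J hJ
    obtain ⟨hJ0, hJ2⟩ := hJ
    have hJ' : (0 : ℝ) < J := by exact_mod_cast hJ0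
    have hu0 : 0 < 1 / (t * (J : ℝ)) := by positivity
    have hu1 : 1 / (t * (J : ℝ)) < 1 / 2 := by
      apply one_div_lt_one_div_of_lt <;> linarith
    set u := 1 / (t * (J : ℝ)) with hu
    have hT : 0 < t * (J : ℝ) ^ 2 := by positivity
    have hJu : (J : ℝ) = u * (t * (J : ℝ) ^ 2) := by rw [hu]; field_simp
    set T := t * (J : ℝ) ^ 2 with hTdef
    have hu2 : 0 < 1 - u := by linarith
    refine ⟨by positivity, by positivity, ?_⟩
    intro P hP Q hQ hD
    obtain ⟨⟨hP1, hP2⟩, hP3, hP4⟩ := cast_mem_rect hP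
    obtain ⟨⟨hQ1, hQ2⟩, hQ3, hQ4⟩ := cast_mem_rect hQ
    have hTP : (1 - u) * T ≤ T + P.1 := by nlinarith
    have hTQ : (1 - u) * T ≤ T + Q.1 := by nlinarith
    have hTP' : T + P.1 ≤ (1 + u) * T := by nlinarith
    have hTQ' : T + Q.1 ≤ (1 + u) * T := by nlinarith
    have hT1 : 0 < (1 - u) * T := by positivity
    have hTP0 : 0 < T + P.1 := by linarith
    have hTQ0 : 0 < T + Q.1 := by linarith
    rw [viewAngle_eq_arctan hT hP3 hTP0, viewAngle_eq_arctan hT hQ3 hTQ0]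
    set s := (P.2 : ℝ) / (T + P.1) with hs
    set s' := (Q.2 : ℝ) / (T + Q.1) with hs'
    have hDs : slopeDiff t J P Q * (t ^ 2 * J ^ 4) / ((T + P.1) * (T + Q.1))
        = 2 * t * (J : ℝ) ^ 3 * (s' - s) := by
      rw [slopeDiff, hs, hs', ← hTdef]
      field_simp
    have hT2 : t ^ 2 * (J : ℝ) ^ 4 = T ^ 2 := by rw [hTdef]; ring
    rw [hT2] at hDs
    set D := slopeDiff t J P Q
    have hpos : 0 < 2 * t * (J : ℝ) ^ 3 := by positivity
    have hss : s ≤ s' := by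
      have : 0 ≤ 2 * t * (J : ℝ) ^ 3 * (s' - s) := by rw [← hDs]; positivity
      nlinarith [nonneg_of_mul_nonneg_right this hpos]
    have hs0 : 0 ≤ s := by positivity
    have hsσ : s' ≤ u * (1 - u)⁻¹ := by
      rw [hs', div_le_iff₀ hTQ0]
      calc (Q.2 : ℝ) ≤ u * T := by linarith
        _ = u * (1 - u)⁻¹ * ((1 - u) * T) := by field_simp
        _ ≤ _ := by gcongr
    have h1 := arctan_sub_arctan_le hss
    have h2 := le_arctan_sub_arctan hs0 hss hsσ
    constructor
    · refine le_trans ?_ (mul_le_mul_of_nonneg_left h2 hpos.le)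
      rw [← mul_assoc, ← hDs, mul_right_comm]
      gcongr ?_ * _
      rw [inv_mul_eq_div, div_le_div_iff₀ (by positivity) (by positivity),
        mul_assoc]
      refine mul_le_mul_of_nonneg_left ?_ hD
      calc (T + P.1) * (T + Q.1) ≤ ((1 + u) * T) * ((1 + u) * T) := by gcongr
        _ = _ := by ring
    · refine le_trans (mul_le_mul_of_nonneg_left h1 hpos.le) ?_
      rw [← hDs, inv_mul_eq_div, div_le_div_iff₀ (by positivity) (by positivity),
        mul_assoc]
      refine mul_le_mul_of_nonneg_left ?_ hD
      calc T ^ 2 * (1 - u) ^ 2 = ((1 - u) * T) * ((1 - u) * T) := by ring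
        _ ≤ _ := by gcongr

/-- The top left corner `(-J, J)` has both the largest ordinate and the smallest distance `T + a`,
so it is seen under the largest angle. -/
lemma alpha_numPts {t : ℝ} (ht : 0 < t) {J : ℕ} (hJ0 : 0 < J) (hJ : 2 < t * (J : ℝ)) :
    alpha t J (numPts J) = Real.arctan (J / (t * (J : ℝ) ^ 2 - J)) := by
  have hJ' : (0 : ℝ) < J := by exact_mod_cast hJ0
  have hT : 0 < t * (J : ℝ) ^ 2 := by positivity
  have hTJ : (J : ℝ) < t * (J : ℝ) ^ 2 := by nlinarith
  have hP : (-(J : ℤ), (J : ℤ)) ∈ rect J := by rw [mem_rect]; simp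
  have hv : viewAngle t J (-(J : ℤ), (J : ℤ)) = Real.arctan (J / (t * (J : ℝ) ^ 2 - J)) := by
    rw [viewAngle_eq_arctan hT (by simp) (by push_cast; linarith)]
    push_cast
    rw [← sub_eq_add_neg]
  rw [← hv]
  refine getD_sort_eq_of_forall_le _ _ hP fun Q hQ => ?_
  obtain ⟨⟨hQ1, hQ2⟩, hQ3, hQ4⟩ := cast_mem_rect hQ
  rw [hv, viewAngle_eq_arctan hT hQ3 (by linarith)]
  apply Real.arctan_mono
  apply div_le_div₀ <;> linarith

/-- The largest angle is asymptotic to `1/(tJ)` and the number of points to `2J²`; this fixes the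
scale `2tJ³` used for all angle differences. -/
lemma tendsto_mul_avgGap {t : ℝ} (ht : 0 < t) :
    Tendsto (fun J : ℕ => 2 * t * (J : ℝ) ^ 3 * avgGap t J) atTop (𝓝 1) := by
  have h0 := tendsto_one_div_mul_natCast ht
  have h1 := tendsto_one_div_mul_natCast one_pos
  have hd : HasDerivAt Real.arctan 1 0 := by simpa using Real.hasDerivAt_arctan 0
  have hslope : Tendsto (fun u : ℝ => u⁻¹ * Real.arctan u) (𝓝[≠] 0) (𝓝 1) := by
    have := hd.tendsto_slope
    simpa [slope_fun_def] using this
  have hs : Tendsto (fun J : ℕ => 1 / (t * (J : ℝ)) * (1 - 1 / (t * (J : ℝ)))⁻¹) atTop (𝓝 0) := by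
    have : ContinuousAt (fun u : ℝ => u * (1 - u)⁻¹) 0 := by
      fun_prop (disch := simp)
    simpa [Function.comp_def] using this.tendsto.comp h0
  have hs' : Tendsto (fun J : ℕ => 1 / (t * (J : ℝ)) * (1 - 1 / (t * (J : ℝ)))⁻¹) atTop
      (𝓝[≠] 0) := by
    refine tendsto_nhdsWithin_iff.2 ⟨hs, ?_⟩
    filter_upwards [eventually_two_lt_mul ht] with J hJ
    have hu1 : 1 / (t * (J : ℝ)) < 1 / 2 := by
      apply one_div_lt_one_div_of_lt <;> linarith [hJ.2]
    have hJ' : (0 : ℝ) < J := by exact_mod_cast hJ.1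
    have hu2 : 0 < 1 - 1 / (t * (J : ℝ)) := by linarith
    have : 0 < 1 / (t * (J : ℝ)) * (1 - 1 / (t * (J : ℝ)))⁻¹ := by positivity
    exact this.ne'
  have hA := hslope.comp hs'
  have hB : Tendsto (fun J : ℕ => ((1 - 1 / (t * (J : ℝ)))⁻¹ *
      ((1 + 1 / 2 * (1 / (1 * (J : ℝ)))) * (1 + 1 / (1 * (J : ℝ))))⁻¹)) atTop (𝓝 1) := by
    have c1 : ContinuousAt (fun u : ℝ => (1 - u)⁻¹) 0 := by
      fun_prop (disch := simp)
    have c2 : ContinuousAt (fun u : ℝ => ((1 + 1 / 2 * u) * (1 + u))⁻¹) 0 := by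
      fun_prop (disch := simp)
    simpa [Function.comp_def] using (c1.tendsto.comp h0).mul (c2.tendsto.comp h1)
  have hAB := hA.mul hB
  rw [mul_one] at hAB
  refine hAB.congr' ?_
  filter_upwards [eventually_two_lt_mul ht] with J hJ
  have hJ' : (0 : ℝ) < J := by exact_mod_cast hJ.1
  have hu1 : 1 / (t * (J : ℝ)) < 1 / 2 := by
    apply one_div_lt_one_div_of_lt <;> linarith [hJ.2]
  have hu2 : 1 - 1 / (t * (J : ℝ)) ≠ 0 := by linarith
  rw [avgGap, alpha_numPts ht hJ.1 hJ.2, numPts_eq]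
  have e1 : (J : ℝ) / (t * (J : ℝ) ^ 2 - J) = 1 / (t * (J : ℝ)) * (1 - 1 / (t * (J : ℝ)))⁻¹ := by
    have : t * (J : ℝ) ^ 2 - J = (t * J ^ 2) * (1 - 1 / (t * (J : ℝ))) := by field_simp
    rw [this, div_mul_eq_div_div, div_eq_mul_inv _ (1 - 1 / (t * (J : ℝ)))]
    congr 1
    field_simp
  rw [e1]
  change ((1 / (t * (J : ℝ)) * (1 - 1 / (t * (J : ℝ)))⁻¹)⁻¹ *
    Real.arctan (1 / (t * (J : ℝ)) * (1 - 1 / (t * (J : ℝ)))⁻¹)) * _ = _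
  have hu3 : (1 - 1 / (t * (J : ℝ)))⁻¹ ≠ 0 := inv_ne_zero hu2
  generalize (1 - 1 / (t * (J : ℝ)))⁻¹ = v at *
  generalize Real.arctan _ = A
  push_cast
  field_simp

/-! ### Riemann sums and exponential sums along a column -/

/-- Riemann sums of a continuous function. -/
lemma tendsto_riemann_sum {E : Type*} [NormedAddCommGroup E] [NormedSpace ℝ E] [CompleteSpace E]
    {f : ℝ → E} (hf : Continuous f) :
    Tendsto (fun J : ℕ => (J : ℝ)⁻¹ • ∑ i ∈ Finset.range J, f ((i + 1 : ℝ) / J)) atTop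
      (𝓝 (∫ x in (0 : ℝ)..1, f x)) := by
  rw [Metric.tendsto_atTop]
  intro ε hε
  have huc : UniformContinuousOn f (Set.Icc 0 1) :=
    isCompact_Icc.uniformContinuousOn_of_continuous hf.continuousOn
  obtain ⟨δ, hδ, hδf⟩ := Metric.uniformContinuousOn_iff.1 huc (ε / 2) (by positivity)
  obtain ⟨M, hM⟩ := exists_nat_gt (1 / δ)
  refine ⟨M + 1, fun J hJ => ?_⟩
  have hJ0 : (0 : ℝ) < J := by exact_mod_cast (by omega : 0 < J)
  have hJδ : 1 / (J : ℝ) < δ := by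
    rw [one_div_lt hJ0 hδ]
    refine hM.trans ?_
    exact_mod_cast (by omega : M < J)
  have hint : ∀ a b : ℝ, IntervalIntegrable f MeasureTheory.volume a b :=
    fun a b => hf.intervalIntegrable a b
  have hsum : ∫ x in (0 : ℝ)..1, f x
      = ∑ i ∈ Finset.range J, ∫ x in ((i : ℝ) / J)..((i + 1 : ℕ) : ℝ) / J, f x := by
    rw [intervalIntegral.sum_integral_adjacent_intervals (a := fun i : ℕ => (i : ℝ) / J)
      (fun k _ => hint _ _)]
    simp [hJ0.ne']
  have hconst : (J : ℝ)⁻¹ • ∑ i ∈ Finset.range J, f ((i + 1 : ℝ) / J)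
      = ∑ i ∈ Finset.range J, ∫ _x in ((i : ℝ) / J)..((i + 1 : ℕ) : ℝ) / J,
          f ((i + 1 : ℝ) / J) := by
    rw [Finset.smul_sum]
    refine Finset.sum_congr rfl fun i _ => ?_
    rw [intervalIntegral.integral_const]
    congr 1
    push_cast
    field_simp
    ring
  rw [dist_eq_norm, hsum, hconst, ← Finset.sum_sub_distrib]
  calc _ ≤ ∑ i ∈ Finset.range J, (ε / 2) * (1 / J) := by
        refine norm_sum_le_of_le _ fun i hi => ?_
        have hi : (i : ℝ) + 1 ≤ J := by exact_mod_cast Finset.mem_range.1 hi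
        rw [← intervalIntegral.integral_sub (by simp) (hint _ _)]
        have hle : (i : ℝ) / J ≤ ((i + 1 : ℕ) : ℝ) / J := by
          push_cast; gcongr; linarith
        refine (intervalIntegral.norm_integral_le_of_norm_le_const (C := ε / 2) ?_).trans ?_
        · intro x hx
          rw [Set.uIoc_of_le hle] at hx
          have h1 := hx.1; have h2 := hx.2
          push_cast at h2
          have h0 : 0 ≤ (i : ℝ) / J := by positivity
          have h3 : ((i : ℝ) + 1) / J ≤ 1 := by rw [div_le_one hJ0]; exact hi
          have h4 : ((i : ℝ) + 1) / J = (i : ℝ) / J + 1 / J := by ring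
          rw [← dist_eq_norm]
          refine (hδf _ ⟨by positivity, h3⟩ _ ⟨by linarith, by linarith⟩ ?_).le
          rw [Real.dist_eq, abs_of_nonneg (by linarith)]
          linarith
        · apply le_of_eq
          congr 1
          rw [abs_of_nonneg (by linarith)]
          push_cast; ring
    _ = ε / 2 := by
        rw [Finset.sum_const, Finset.card_range, nsmul_eq_mul]
        field_simp
    _ < ε := by linarith

/-- The additive character `x ↦ exp (2πix)`. -/
def cis (x : ℝ) : ℂ := Complex.exp (((2 * Real.pi * x : ℝ) : ℂ) * Complex.I)

lemma norm_cis (x : ℝ) : ‖cis x‖ = 1 := Complex.norm_exp_ofReal_mul_I _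

lemma cis_add (x y : ℝ) : cis (x + y) = cis x * cis y := by
  rw [cis, cis, cis, ← Complex.exp_add]; congr 1; push_cast; ring

lemma cis_zero : cis 0 = 1 := by simp [cis]

lemma cis_eq_one_iff {x : ℝ} : cis x = 1 ↔ ∃ n : ℤ, x = n := by
  rw [cis, Complex.exp_eq_one_iff]
  refine exists_congr fun n => ?_
  have : ((n : ℂ) * (2 * Real.pi * Complex.I)) = ((2 * Real.pi * n : ℝ) : ℂ) * Complex.I := by
    push_cast; ring
  rw [this, mul_left_inj' Complex.I_ne_zero, Complex.ofReal_inj,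
    mul_right_inj' (by positivity)]

lemma continuous_cis : Continuous cis := by unfold cis; fun_prop

lemma norm_cis_sub_cis_le (x y : ℝ) : ‖cis x - cis y‖ ≤ 2 * Real.pi * |x - y| := by
  have h : cis x - cis y = cis y * (cis (x - y) - 1) := by
    rw [mul_sub, ← cis_add]; ring_nf
  rw [h, norm_mul, norm_cis, one_mul, cis, mul_comm]
  refine (Real.norm_exp_I_mul_ofReal_sub_one_le).trans ?_
  rw [Real.norm_eq_abs, abs_mul, abs_of_pos (by positivity : (0 : ℝ) < 2 * Real.pi)]

/-- The increment `e(-c/w²) - 1` of the phase. -/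
def phaseStep (c w : ℝ) : ℂ := cis (-c / w ^ 2) - 1

lemma norm_phaseStep_le (c w : ℝ) : ‖phaseStep c w‖ ≤ 2 := by
  refine (norm_sub_le _ _).trans ?_
  rw [norm_cis, norm_one]; norm_num

lemma continuousAt_phaseStep (c : ℝ) {w : ℝ} (hw : w ≠ 0) : ContinuousAt (phaseStep c) w := by
  have : ContinuousAt (fun w : ℝ => -c / w ^ 2) w := by
    fun_prop (disch := positivity)
  exact (continuous_cis.continuousAt.comp this).sub continuousAt_const

/-- The phase increment oscillates without limit as `w → 0`; a damping factor restores continuity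
there. The exponent 3 is chosen to absorb the error `J²/b³` in `norm_stepInv_mul_phase_le`. -/
lemma continuous_abs_pow_smul {g : ℝ → ℂ} {C : ℝ} (hg : ∀ w, ‖g w‖ ≤ C)
    (hc : ∀ w, w ≠ 0 → ContinuousAt g w) : Continuous fun w : ℝ => |w| ^ 3 • g w := by
  rw [continuous_iff_continuousAt]
  intro w
  by_cases hw : w = 0
  · subst hw
    rw [ContinuousAt]
    simp only [abs_zero, ne_eq, OfNat.ofNat_ne_zero, not_false_eq_true, zero_pow, zero_smul]
    refine squeeze_zero_norm (a := fun w : ℝ => |w| ^ 3 * C) (fun w => ?_) ?_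
    · rw [norm_smul, norm_pow, Real.norm_eq_abs, abs_abs]
      exact mul_le_mul_of_nonneg_left (hg w) (by positivity)
    · have : Continuous fun w : ℝ => |w| ^ 3 * C := by fun_prop
      simpa using this.tendsto 0
  · have h3 : ContinuousAt (fun w : ℝ => |w| ^ 3) w := by fun_prop
    exact h3.smul (hc w hw)

/-- The regularised denominator `|w|³ |e(-c/w²) - 1|² + δ`. -/
def den (c δ w : ℝ) : ℝ := |w| ^ 3 * ‖phaseStep c w‖ ^ 2 + δ

lemma continuous_den (c δ : ℝ) : Continuous (den c δ) := by
  have h : Continuous fun w : ℝ => |w| ^ 3 • (((‖phaseStep c w‖ ^ 2 : ℝ)) : ℂ) := by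
    refine continuous_abs_pow_smul (C := 4) (fun w => ?_) fun w hw => ?_
    · rw [Complex.norm_real, norm_pow, norm_norm]
      nlinarith [norm_phaseStep_le c w, norm_nonneg (phaseStep c w)]
    · exact Complex.continuous_ofReal.continuousAt.comp
        ((continuousAt_phaseStep c hw).norm.pow 2)
  have h2 := Complex.continuous_re.comp h
  refine (h2.add_const δ).congr fun w => ?_
  rw [Function.comp_apply, Complex.real_smul, ← Complex.ofReal_mul, Complex.ofReal_re, den]

lemma le_den (c δ w : ℝ) : δ ≤ den c δ w := by
  unfold den; linarith [show 0 ≤ |w| ^ 3 * ‖phaseStep c w‖ ^ 2 by positivity]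

/-- A continuous approximate inverse of the phase increment. -/
def stepInv (c δ w : ℝ) : ℂ :=
  (|w| ^ 3 • (starRingEnd ℂ) (phaseStep c w)) / (den c δ w : ℂ)

lemma continuous_stepInv (c : ℝ) {δ : ℝ} (hδ : 0 < δ) : Continuous (stepInv c δ) := by
  refine Continuous.div ?_ (Complex.continuous_ofReal.comp (continuous_den c δ)) fun w => ?_
  · refine continuous_abs_pow_smul (C := 2) (fun w => ?_) fun w hw => ?_
    · rw [RCLike.norm_conj]; exact norm_phaseStep_le c w
    · exact Complex.continuous_conj.continuousAt.comp (continuousAt_phaseStep c hw)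
  · exact_mod_cast (hδ.trans_le (le_den c δ w)).ne'

lemma norm_stepInv_le (c : ℝ) {δ : ℝ} (hδ : 0 < δ) (w : ℝ) :
    ‖stepInv c δ w‖ ≤ |w| ^ 3 * 2 / δ := by
  have h := le_den c δ w
  rw [stepInv, norm_div, norm_smul, RCLike.norm_conj, Complex.norm_real, norm_pow,
    Real.norm_eq_abs, abs_abs, Real.norm_eq_abs, abs_of_pos (hδ.trans_le h)]
  gcongr
  exact norm_phaseStep_le c w

/-- Splits 1 into a multiple of the phase increment, to which summation by parts applies, and a
defect that is small except near `w = 0` and the zeros of the increment. -/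
lemma stepInv_mul_phaseStep (c : ℝ) {δ : ℝ} (hδ : 0 < δ) (w : ℝ) :
    (1 : ℂ) = ((δ / den c δ w : ℝ) : ℂ) + stepInv c δ w * phaseStep c w := by
  have h : (den c δ w : ℂ) ≠ 0 := by exact_mod_cast (hδ.trans_le (le_den c δ w)).ne'
  have h2 : (starRingEnd ℂ) (phaseStep c w) * phaseStep c w = ((‖phaseStep c w‖ ^ 2 : ℝ) : ℂ) := by
    rw [mul_comm, Complex.mul_conj, Complex.normSq_eq_norm_sq]
  rw [stepInv, div_mul_eq_mul_div, smul_mul_assoc, h2, Complex.ofReal_div, ← add_div, eq_div_iff h,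
    one_mul, Complex.real_smul, ← Complex.ofReal_mul, ← Complex.ofReal_add, den, add_comm]

/-- A zero forces `c/w²` to be an integer, and `w ↦ -c/w²` is injective on `w > 0`, so the zeros are
countable. -/
lemma ae_phaseStep_ne_zero {c : ℝ} (hc : c ≠ 0) :
    ∀ᵐ w ∂(MeasureTheory.volume.restrict (Set.Ioc (0 : ℝ) 1)), phaseStep c w ≠ 0 := by
  rw [MeasureTheory.ae_restrict_iff' measurableSet_Ioc]
  have hcount : {w : ℝ | 0 < w ∧ phaseStep c w = 0}.Countable := by
    refine Set.MapsTo.countable_of_injOn (f := fun w : ℝ => -c / w ^ 2)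
      (t := Set.range ((↑) : ℤ → ℝ)) ?_ ?_ (Set.countable_range _)
    · rintro w ⟨hw, h⟩
      obtain ⟨n, hn⟩ := cis_eq_one_iff.1 (sub_eq_zero.1 h)
      exact ⟨n, hn.symm⟩
    · rintro w ⟨hw, -⟩ w' ⟨hw', -⟩ h
      have h : -c / w ^ 2 = -c / w' ^ 2 := h
      rw [div_eq_div_iff (by positivity) (by positivity),
        mul_right_inj' (neg_ne_zero.2 hc)] at h
      exact ((pow_left_inj₀ hw.le hw'.le two_ne_zero).1 h.symm)
  filter_upwards [MeasureTheory.measure_eq_zero_iff_ae_notMem.1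
    (hcount.measure_zero MeasureTheory.volume)] with w hw hw1 h0
  exact hw ⟨hw1.1, h0⟩

lemma tendsto_integral_den {c : ℝ} (hc : c ≠ 0) :
    Tendsto (fun m : ℕ => ∫ w in (0 : ℝ)..1, 1 / ((m : ℝ) + 1) / den c (1 / ((m : ℝ) + 1)) w)
      atTop (𝓝 0) := by
  have h : Tendsto (fun m : ℕ => ∫ w in (0 : ℝ)..1, 1 / ((m : ℝ) + 1) /
      den c (1 / ((m : ℝ) + 1)) w) atTop (𝓝 (∫ w in (0 : ℝ)..1, (0 : ℝ))) := by
    simp only [intervalIntegral.integral_of_le zero_le_one]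
    refine MeasureTheory.tendsto_integral_of_dominated_convergence (fun _ => 1) ?_ ?_ ?_ ?_
    · intro m
      have : Continuous fun w => 1 / ((m : ℝ) + 1) / den c (1 / ((m : ℝ) + 1)) w :=
        continuous_const.div (continuous_den c _) fun w =>
          ((by positivity : 0 < 1 / ((m : ℝ) + 1)).trans_le (le_den c _ w)).ne'
      exact this.aestronglyMeasurable
    · simp
    · intro m
      refine Filter.Eventually.of_forall fun w => ?_
      have h1 : 0 < 1 / ((m : ℝ) + 1) := by positivity
      have h2 := le_den c (1 / ((m : ℝ) + 1)) w
      rw [Real.norm_of_nonneg (div_nonneg h1.le (h1.le.trans h2)), div_le_one (h1.trans_le h2)]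
      exact h2
    · filter_upwards [ae_phaseStep_ne_zero hc,
        MeasureTheory.ae_restrict_mem measurableSet_Ioc] with w hw hw1
      have h0 : ContinuousAt (fun δ : ℝ => δ / den c δ w) 0 := by
        have : den c 0 w ≠ 0 := by
          have := norm_pos_iff.2 hw
          have := hw1.1
          unfold den; positivity
        unfold den at *
        fun_prop (disch := assumption)
      have := h0.tendsto.comp (tendsto_one_div_add_atTop_nhds_zero_nat (𝕜 := ℝ))
      simpa [Function.comp_def] using this
  simpa using h

/-- The character `(w, x, z) ↦ e(pw + nz)` along a vertical line of lattice points. -/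
def phase (t : ℝ) (J : ℕ) (a p : ℝ) (n : ℤ) (b : ℝ) : ℂ :=
  cis (p * (b / J) + n * ((t * (J : ℝ) ^ 2 + a) / b))

/-- The actual increment of `(tJ² + a)/b` differs from `-t/w²` by `(tJ² - ab)/(b²(b + 1))` in
absolute value, hence by at most `(t + 1)J²/b³`. The factor `(b/J)³` from `norm_stepInv_le` reduces
this to `O(1/J)`, even for small `b`. -/
lemma norm_stepInv_mul_phase_le {t : ℝ} (ht : 0 < t) {J : ℕ} (hJ : 0 < J) {a : ℝ} (ha : |a| ≤ J)
    (p : ℝ) (n : ℤ) {δ : ℝ} (hδ : 0 < δ) {b : ℝ} (hb : 0 < b) (hbJ : b ≤ J) :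
    ‖stepInv (n * t) δ (b / J) * (phase t J a p n b * phaseStep (n * t) (b / J) -
      (phase t J a p n (b + 1) - phase t J a p n b))‖ ≤
      2 / δ * (2 * Real.pi) * (|p| + |(n : ℝ)| * (t + 1)) / J := by
  have hJ' : (0 : ℝ) < J := by exact_mod_cast hJ
  have e1 : phase t J a p n b * phaseStep (n * t) (b / J) -
      (phase t J a p n (b + 1) - phase t J a p n b) =
      cis (p * (b / J) + n * ((t * (J : ℝ) ^ 2 + a) / b) + -(n * t) / (b / J) ^ 2) -
        cis (p * ((b + 1) / J) + n * ((t * (J : ℝ) ^ 2 + a) / (b + 1))) := by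
    rw [cis_add]; unfold phase phaseStep; ring
  rw [e1, norm_mul]
  have e2 : p * (b / J) + n * ((t * (J : ℝ) ^ 2 + a) / b) + -(n * t) / (b / J) ^ 2 -
      (p * ((b + 1) / J) + n * ((t * (J : ℝ) ^ 2 + a) / (b + 1))) =
      -(p / J + n * ((t * (J : ℝ) ^ 2 - a * b) / (b ^ 2 * (b + 1)))) := by
    field_simp
    ring
  have h1 := norm_cis_sub_cis_le
    (p * (b / J) + n * ((t * (J : ℝ) ^ 2 + a) / b) + -(n * t) / (b / J) ^ 2)
    (p * ((b + 1) / J) + n * ((t * (J : ℝ) ^ 2 + a) / (b + 1)))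
  rw [e2, abs_neg] at h1
  have h2 := norm_stepInv_le (n * t) hδ (b / J)
  rw [abs_of_pos (by positivity : 0 < b / J)] at h2
  have h3 : |p / J + n * ((t * (J : ℝ) ^ 2 - a * b) / (b ^ 2 * (b + 1)))| ≤
      |p| / J + |(n : ℝ)| * ((t + 1) * J ^ 2 / b ^ 3) := by
    refine (abs_add_le _ _).trans ?_
    rw [abs_div, abs_of_pos hJ', abs_mul, abs_div, abs_of_pos (by positivity : 0 < b ^ 2 * (b + 1))]
    gcongr
    · calc |t * (J : ℝ) ^ 2 - a * b| ≤ |t * (J : ℝ) ^ 2| + |a * b| := abs_sub _ _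
        _ = t * (J : ℝ) ^ 2 + |a| * b := by rw [abs_mul a b, abs_of_pos hb, abs_of_pos (by positivity)]
        _ ≤ t * (J : ℝ) ^ 2 + J * J := by gcongr
        _ = _ := by ring
    · nlinarith [sq_nonneg b]
  have hbJ1 : b / J ≤ 1 := by rw [div_le_one hJ']; exact hbJ
  have h4 : (b / J) ^ 3 ≤ 1 := pow_le_one₀ (by positivity) hbJ1
  calc _ ≤ ((b / J) ^ 3 * 2 / δ) *
        (2 * Real.pi * (|p| / J + |(n : ℝ)| * ((t + 1) * J ^ 2 / b ^ 3))) := by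
        refine mul_le_mul h2 (h1.trans ?_) (norm_nonneg _) (by positivity)
        gcongr
    _ = 2 / δ * (2 * Real.pi) * ((b / J) ^ 3 * (|p| / J) + |(n : ℝ)| * (t + 1) / J) := by
        field_simp
    _ ≤ 2 / δ * (2 * Real.pi) * (1 * (|p| / J) + |(n : ℝ)| * (t + 1) / J) := by gcongr
    _ = _ := by ring

/-- Summation by parts. The four terms of the bound are the defect, the error of replacing the true
increment by the model one, the two boundary terms, and the variation of `stepInv`. -/
lemma norm_sum_phase_le {t : ℝ} (ht : 0 < t) {J : ℕ} (hJ : 0 < J) {a : ℝ} (ha : |a| ≤ J)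
    (p : ℝ) (n : ℤ) {δ : ℝ} (hδ : 0 < δ) :
    ‖∑ i ∈ Finset.range J, phase t J a p n (i + 1)‖ ≤
      ∑ i ∈ Finset.range J, δ / den (n * t) δ ((i + 1 : ℝ) / J) +
      2 / δ * (2 * Real.pi) * (|p| + |(n : ℝ)| * (t + 1)) + 32 / δ +
      ∑ i ∈ Finset.range J, ‖stepInv (n * t) δ ((i + 1 + 1 : ℝ) / J) -
        stepInv (n * t) δ ((i + 1 : ℝ) / J)‖ := by
  have hJ' : (0 : ℝ) < J := by exact_mod_cast hJ
  have hJ1 : (1 : ℝ) ≤ J := by exact_mod_cast hJ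
  have e1 : ∑ i ∈ Finset.range J, phase t J a p n (i + 1) =
      ∑ i ∈ Finset.range J, ((δ / den (n * t) δ ((i + 1 : ℝ) / J) : ℝ) : ℂ) *
        phase t J a p n (i + 1) +
      ∑ i ∈ Finset.range J, stepInv (n * t) δ ((i + 1 : ℝ) / J) *
        (phase t J a p n (i + 1) * phaseStep (n * t) ((i + 1 : ℝ) / J) -
          (phase t J a p n (i + 1 + 1) - phase t J a p n (i + 1))) +
      ∑ i ∈ Finset.range J, (stepInv (n * t) δ (((i + 1 : ℕ) + 1 : ℝ) / J) *
          phase t J a p n ((i + 1 : ℕ) + 1) -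
        stepInv (n * t) δ ((i + 1 : ℝ) / J) * phase t J a p n (i + 1)) -
      ∑ i ∈ Finset.range J, (stepInv (n * t) δ ((i + 1 + 1 : ℝ) / J) -
        stepInv (n * t) δ ((i + 1 : ℝ) / J)) * phase t J a p n (i + 1 + 1) := by
    rw [← Finset.sum_add_distrib, ← Finset.sum_add_distrib, ← Finset.sum_sub_distrib]
    refine Finset.sum_congr rfl fun i _ => ?_
    push_cast
    have := stepInv_mul_phaseStep (n * t) hδ ((i + 1 : ℝ) / J)
    calc phase t J a p n (i + 1) = 1 * phase t J a p n (i + 1) := (one_mul _).symm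
      _ = _ := by
        rw [this]; push_cast; ring
  have hph : ∀ b, ‖phase t J a p n b‖ = 1 := fun b => norm_cis _
  rw [e1, Finset.sum_range_sub (fun i : ℕ => stepInv (n * t) δ ((i + 1 : ℝ) / J) *
    phase t J a p n (i + 1))]
  refine (norm_sub_le _ _).trans (add_le_add ((norm_add_le _ _).trans (add_le_add
    ((norm_add_le _ _).trans (add_le_add ?_ ?_)) ?_)) ?_)
  · refine norm_sum_le_of_le _ fun i _ => ?_
    rw [norm_mul, hph, mul_one, Complex.norm_real, Real.norm_of_nonneg]
    exact div_nonneg hδ.le (hδ.le.trans (le_den _ _ _))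
  · refine (norm_sum_le_of_le (f := fun i : ℕ => stepInv (n * t) δ ((i + 1 : ℝ) / J) *
        (phase t J a p n (i + 1) * phaseStep (n * t) ((i + 1 : ℝ) / J) -
          (phase t J a p n (i + 1 + 1) - phase t J a p n (i + 1)))) _ fun i hi =>
      norm_stepInv_mul_phase_le ht hJ ha p n hδ (b := (i : ℝ) + 1) (by positivity) (by
        exact_mod_cast Finset.mem_range.1 hi)).trans (le_of_eq ?_)
    rw [Finset.sum_const, Finset.card_range, nsmul_eq_mul]
    field_simp
  · have hend : ∀ b : ℝ, 0 ≤ b → b ≤ 2 * J → ‖stepInv (n * t) δ (b / J)‖ ≤ 16 / δ := by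
      intro b hb hb2
      refine (norm_stepInv_le _ hδ _).trans ?_
      gcongr
      rw [abs_of_nonneg (by positivity)]
      have h1 : b / J ≤ 2 := by rw [div_le_iff₀ hJ']; exact hb2
      have h2 : (b / J) ^ 3 ≤ 2 ^ 3 := pow_le_pow_left₀ (by positivity) h1 3
      linarith
    refine (norm_sub_le _ _).trans ?_
    rw [norm_mul, norm_mul, hph, hph, mul_one, mul_one]
    have h1 := hend (J + 1) (by positivity) (by linarith)
    have h2 := hend ((0 : ℕ) + 1) (by positivity) (by push_cast; linarith)
    refine (add_le_add h1 h2).trans (le_of_eq (by ring))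
  · refine norm_sum_le_of_le _ fun i _ => ?_
    rw [norm_mul, hph, mul_one]

lemma eventually_norm_sum_phase_le {t : ℝ} (ht : 0 < t) (p : ℝ) {n : ℤ} (hn : n ≠ 0)
    {ε : ℝ} (hε : 0 < ε) :
    ∀ᶠ J : ℕ in atTop, ∀ a : ℝ, |a| ≤ J →
      ‖∑ i ∈ Finset.range J, phase t J a p n (i + 1)‖ ≤ ε * J := by
  have hc : (n : ℝ) * t ≠ 0 := mul_ne_zero (by exact_mod_cast hn) ht.ne'
  obtain ⟨m, hm⟩ := ((tendsto_integral_den hc).eventually_lt_const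
    (by positivity : 0 < ε / 3)).exists
  set δ : ℝ := 1 / ((m : ℝ) + 1) with hδdef
  have hδ : 0 < δ := by positivity
  have hcont : Continuous fun w => δ / den (n * t) δ w :=
    continuous_const.div (continuous_den _ _) fun w => (hδ.trans_le (le_den _ _ w)).ne'
  have hR := (tendsto_riemann_sum hcont).eventually_lt_const hm
  -- The interval reaches 2 because the shifted argument `(i + 2)/J` can exceed 1.
  have huc : UniformContinuousOn (stepInv (n * t) δ) (Set.Icc 0 2) :=
    isCompact_Icc.uniformContinuousOn_of_continuous (continuous_stepInv _ hδ).continuousOn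
  obtain ⟨η, hη, hηf⟩ := Metric.uniformContinuousOn_iff.1 huc (ε / 3) (by positivity)
  set K := 2 / δ * (2 * Real.pi) * (|p| + |(n : ℝ)| * (t + 1)) + 32 / δ
  have hlarge : ∀ᶠ J : ℕ in atTop, 3 * K / ε + 1 / η + 1 < J :=
    tendsto_natCast_atTop_atTop.eventually_gt_atTop _
  filter_upwards [hR, hlarge] with J hRJ hJ a ha
  have hK : 0 ≤ K := by positivity
  have hJ1 : (1 : ℝ) < J := by
    have : 0 ≤ 3 * K / ε + 1 / η := by positivity
    linarith
  have hJ' : (0 : ℝ) < J := by linarith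
  have hKJ : K ≤ ε / 3 * J := by
    have h0 : 0 ≤ 1 / η := by positivity
    have : 3 * K / ε ≤ J := by linarith
    rw [div_le_iff₀ hε] at this
    linarith
  have hηJ : 1 / (J : ℝ) < η := by
    rw [one_div_lt hJ' hη]
    have : 0 ≤ 3 * K / ε := by positivity
    linarith
  refine (norm_sum_phase_le ht (by exact_mod_cast hJ') ha p n hδ).trans ?_
  have h1 : ∑ i ∈ Finset.range J, δ / den (n * t) δ ((i + 1 : ℝ) / J) ≤ ε / 3 * J := by
    rw [smul_eq_mul, inv_mul_lt_iff₀ hJ'] at hRJ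
    linarith
  have h2 : ∑ i ∈ Finset.range J, ‖stepInv (n * t) δ ((i + 1 + 1 : ℝ) / J) -
        stepInv (n * t) δ ((i + 1 : ℝ) / J)‖ ≤ ε / 3 * J := by
    refine (Finset.sum_le_card_nsmul _ _ (ε / 3) fun i hi => ?_).trans (le_of_eq ?_)
    · have hi : (i : ℝ) + 1 ≤ J := by exact_mod_cast Finset.mem_range.1 hi
      rw [← dist_eq_norm]
      refine (hηf _ ⟨by positivity, ?_⟩ _ ⟨by positivity, ?_⟩ ?_).le
      · rw [div_le_iff₀ hJ']; linarith
      · rw [div_le_iff₀ hJ']; linarith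
      · rw [Real.dist_eq, ← sub_div, add_sub_cancel_left, abs_of_pos (by positivity)]
        exact hηJ
    · rw [Finset.card_range, nsmul_eq_mul, mul_comm]
  linarith

/-! ### Equidistribution of the samples -/

/-- The normalised position and phase of a lattice point. -/
def sample (t : ℝ) (J : ℕ) (P : ℤ × ℤ) : ℝ × ℝ × UnitAddCircle :=
  ((P.2 : ℝ) / J, (P.1 : ℝ) / J, (((t * (J : ℝ) ^ 2 + P.1) / P.2 : ℝ) : UnitAddCircle))

/-- The uniform distribution on the samples of the lattice points of the rectangle. -/
def empirical (t : ℝ) (J : ℕ) : Measure (ℝ × ℝ × UnitAddCircle) :=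
  (numPts J : ℝ≥0∞)⁻¹ • ∑ P ∈ rect J, Measure.dirac (sample t J P)

/-- The limiting distribution of the samples. -/
def limitMeasure : Measure (ℝ × ℝ × UnitAddCircle) :=
  (volume.restrict (Set.Icc 0 1)).prod
    (((2 : ℝ≥0∞)⁻¹ • volume.restrict (Set.Icc (-1) 1)).prod volume)

lemma numPts_pos (J : ℕ) : 0 < numPts J := by rw [numPts_eq]; positivity

instance (t : ℝ) (J : ℕ) : IsProbabilityMeasure (empirical t J) := ⟨by
  have h : (numPts J : ℝ≥0∞) ≠ 0 := by exact_mod_cast (numPts_pos J).ne'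
  simp only [empirical, Measure.smul_apply, Measure.finsetSum_apply, measure_univ,
    Finset.sum_const, smul_eq_mul, nsmul_eq_mul, mul_one]
  exact ENNReal.inv_mul_cancel h (ENNReal.natCast_ne_top _)⟩

instance : IsProbabilityMeasure ((2 : ℝ≥0∞)⁻¹ • volume.restrict (Set.Icc (-1 : ℝ) 1)) := ⟨by
  simp only [Measure.smul_apply, Measure.restrict_apply_univ, Real.volume_Icc, smul_eq_mul]
  norm_num
  exact ENNReal.inv_mul_cancel two_ne_zero ENNReal.ofNat_ne_top⟩

instance : IsProbabilityMeasure (volume.restrict (Set.Icc (0 : ℝ) 1)) := ⟨by simp⟩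

instance : IsProbabilityMeasure (volume : Measure UnitAddCircle) := ⟨UnitAddCircle.measure_univ⟩

instance : IsProbabilityMeasure limitMeasure := by unfold limitMeasure; infer_instance

lemma integral_empirical (t : ℝ) (J : ℕ) (g : ℝ × ℝ × UnitAddCircle → ℂ) :
    ∫ x, g x ∂(empirical t J) = (numPts J : ℂ)⁻¹ * ∑ P ∈ rect J, g (sample t J P) := by
  rw [empirical, integral_smul_measure, integral_finsetSum_measure]
  · simp [integral_dirac]
  · intro P _
    exact integrable_dirac (by simp [enorm_lt_top])

open Classical in
lemma empirical_real_apply (t : ℝ) (J : ℕ) {s : Set (ℝ × ℝ × UnitAddCircle)}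
    (hs : MeasurableSet s) :
    (empirical t J).real s = ((rect J).filter (fun P => sample t J P ∈ s)).card / numPts J := by
  rw [Measure.real, empirical, Measure.smul_apply, Measure.finsetSum_apply, smul_eq_mul,
    ENNReal.toReal_mul, ENNReal.toReal_inv, ENNReal.toReal_natCast, div_eq_inv_mul]
  congr 1
  have : ∀ P ∈ rect J, Measure.dirac (sample t J P) s = if sample t J P ∈ s then 1 else 0 := by
    intro P _
    rw [Measure.dirac_apply' _ hs]
    by_cases h : sample t J P ∈ s <;> simp [h]
  rw [Finset.sum_congr rfl this, Finset.sum_boole, ENNReal.toReal_natCast]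

/-- The characters of `ℝ × ℝ × ℝ/ℤ`. -/
def char3 (k : ℝ × ℝ × ℤ) : (ℝ × ℝ × UnitAddCircle) →ᵇ ℂ :=
  BoundedContinuousFunction.ofNormedAddCommGroup
    (fun x => cis (k.1 * x.1) * (cis (k.2.1 * x.2.1) * fourier k.2.2 x.2.2))
    (by
      have := continuous_cis
      have h := (fourier (T := 1) k.2.2).continuous
      fun_prop) 1 (fun x => by
      rw [norm_mul, norm_mul, norm_cis, norm_cis, fourier_apply, Circle.norm_coe]; norm_num)

lemma char3_apply (k : ℝ × ℝ × ℤ) (x : ℝ × ℝ × UnitAddCircle) :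
    char3 k x = cis (k.1 * x.1) * (cis (k.2.1 * x.2.1) * fourier k.2.2 x.2.2) := rfl

lemma char3_zero : char3 0 = 1 := by
  ext x; simp [char3_apply, cis_zero]

lemma char3_add (k l : ℝ × ℝ × ℤ) : char3 (k + l) = char3 k * char3 l := by
  ext x
  simp only [BoundedContinuousFunction.mul_apply, char3_apply, Prod.fst_add, Prod.snd_add, add_mul,
    cis_add, fourier_add]
  ring

lemma conj_cis (x : ℝ) : (starRingEnd ℂ) (cis x) = cis (-x) := by
  rw [cis, cis, ← Complex.exp_conj, map_mul, Complex.conj_ofReal, Complex.conj_I]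
  push_cast; ring_nf

lemma char3_neg (k : ℝ × ℝ × ℤ) : char3 (-k) = star (char3 k) := by
  ext x
  simp [char3_apply, conj_cis]

/-- The star algebra of trigonometric polynomials. -/
def trigPoly : StarSubalgebra ℂ ((ℝ × ℝ × UnitAddCircle) →ᵇ ℂ) where
  toSubalgebra := Algebra.adjoin ℂ (Set.range char3)
  star_mem' := by
    change Algebra.adjoin ℂ (Set.range char3) ≤ star (Algebra.adjoin ℂ (Set.range char3))
    refine Algebra.adjoin_le ?_
    rintro - ⟨k, rfl⟩
    exact Algebra.subset_adjoin ⟨-k, char3_neg k⟩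

/-- Products of characters are characters, so the generated algebra is their linear span, and
convergence has to be checked on single characters only. -/
lemma trigPoly_toSubmodule :
    Subalgebra.toSubmodule trigPoly.toSubalgebra = Submodule.span ℂ (Set.range char3) := by
  apply Algebra.adjoin_eq_span_of_subset
  refine Set.Subset.trans ?_ Submodule.subset_span
  intro x hx
  refine Submonoid.closure_induction (fun _ => id) ⟨0, char3_zero⟩ ?_ hx
  rintro - - - - ⟨m, rfl⟩ ⟨n, rfl⟩
  exact ⟨m + n, char3_add m n⟩

lemma cis_mul_injective {x y : ℝ} (h : ∀ p, cis (p * x) = cis (p * y)) : x = y := by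
  by_contra hxy
  have hd : x - y ≠ 0 := sub_ne_zero.2 hxy
  -- This frequency makes the phases at `x` and `y` differ by exactly one half.
  have h1 := h ((x - y)⁻¹ * (1 / 2))
  have h2 : cis ((x - y)⁻¹ * (1 / 2) * (x - y)) = 1 := by
    rw [mul_sub, sub_eq_add_neg, cis_add, h1, ← cis_add, add_neg_cancel, cis_zero]
  obtain ⟨n, hn⟩ := cis_eq_one_iff.1 h2
  have h3 : (x - y)⁻¹ * (1 / 2) * (x - y) = 1 / 2 := by field_simp
  rw [h3] at hn
  have h4 : (1 : ℝ) = ((2 * n : ℤ) : ℝ) := by push_cast; linarith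
  have h5 : (1 : ℤ) = 2 * n := by exact_mod_cast h4
  omega

lemma separatesPoints_trigPoly :
    (trigPoly.map (BoundedContinuousFunction.toContinuousMapStarₐ ℂ)).SeparatesPoints := by
  intro x y hxy
  by_contra! hcon
  have h : ∀ k, char3 k x = char3 k y := by
    intro k
    exact hcon _ ⟨BoundedContinuousFunction.toContinuousMapStarₐ ℂ (char3 k),
      ⟨char3 k, Algebra.subset_adjoin ⟨k, rfl⟩, rfl⟩, rfl⟩
  apply hxy
  refine Prod.ext ?_ (Prod.ext ?_ ?_)
  · refine cis_mul_injective fun p => ?_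
    simpa [char3_apply, cis_zero] using h (p, 0, 0)
  · refine cis_mul_injective fun p => ?_
    simpa [char3_apply, cis_zero] using h (0, p, 0)
  · have h1 : fourier 1 x.2.2 = fourier 1 y.2.2 := by
      simpa [char3_apply, cis_zero] using h (0, 0, 1)
    rw [fourier_one, fourier_one] at h1
    exact AddCircle.injective_toCircle one_ne_zero (Circle.coe_injective h1)

lemma integral_char3_limitMeasure (k : ℝ × ℝ × ℤ) :
    ∫ x, char3 k x ∂limitMeasure = (∫ w in (0 : ℝ)..1, cis (k.1 * w)) *
      ((2 : ℂ)⁻¹ * (∫ x in (-1 : ℝ)..1, cis (k.2.1 * x)) * if k.2.2 = 0 then 1 else 0) := by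
  simp only [char3_apply, limitMeasure]
  rw [integral_prod_mul (fun w => cis (k.1 * w))
    (fun x : ℝ × UnitAddCircle => cis (k.2.1 * x.1) * fourier k.2.2 x.2),
    integral_prod_mul (fun x => cis (k.2.1 * x)) (fun z : UnitAddCircle => fourier k.2.2 z),
    integral_smul_measure]
  rw [intervalIntegral.integral_of_le zero_le_one, intervalIntegral.integral_of_le (by norm_num),
    integral_Icc_eq_integral_Ioc, integral_Icc_eq_integral_Ioc]
  congr 2
  · simp
  · split_ifs with h
    · simp [h]
    · exact integral_eq_zero_of_add_right_eq_neg (fourier_add_half_inv_index h Fact.out)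

lemma fourier_coe_eq_cis (n : ℤ) (z : ℝ) : fourier n (z : UnitAddCircle) = cis (n * z) := by
  rw [fourier_coe_apply, cis]
  congr 1
  push_cast
  ring

lemma sum_Icc_int {E : Type*} [AddCommMonoid E] (J : ℕ) (f : ℤ → E) :
    ∑ b ∈ Finset.Icc (0 : ℤ) J, f b = f 0 + ∑ i ∈ Finset.range J, f (i + 1) := by
  induction J with
  | zero => simp
  | succ J ih =>
    have : Finset.Icc (0 : ℤ) ((J + 1 : ℕ) : ℤ) = insert ((J : ℤ) + 1) (Finset.Icc (0 : ℤ) J) := by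
      ext x; simp only [Finset.mem_Icc, Finset.mem_insert]; push_cast; omega
    rw [this, Finset.sum_insert (by simp), ih, Finset.sum_range_succ]
    rw [add_comm, add_assoc]

lemma sum_Icc_neg_int {E : Type*} [AddCommMonoid E] (J : ℕ) (f : ℤ → E) :
    ∑ b ∈ Finset.Icc (-(J : ℤ)) J, f b =
      f 0 + ∑ i ∈ Finset.range J, (f (i + 1) + f (-(i + 1))) := by
  induction J with
  | zero => simp
  | succ J ih =>
    have : Finset.Icc (-((J + 1 : ℕ) : ℤ)) ((J + 1 : ℕ) : ℤ) =
        insert ((J : ℤ) + 1) (insert (-((J : ℤ) + 1)) (Finset.Icc (-(J : ℤ)) J)) := by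
      ext x; simp only [Finset.mem_Icc, Finset.mem_insert]; push_cast; omega
    rw [this, Finset.sum_insert (by simp; omega), Finset.sum_insert (by simp), ih,
      Finset.sum_range_succ]
    rw [← add_assoc, add_comm, add_assoc]

lemma sum_char3_sample (t : ℝ) (J : ℕ) (k : ℝ × ℝ × ℤ) :
    ∑ P ∈ rect J, char3 k (sample t J P) =
      ∑ a ∈ Finset.Icc (-(J : ℤ)) J, cis (k.2.1 * (a / J)) *
        ∑ b ∈ Finset.Icc (0 : ℤ) J, phase t J a k.1 k.2.2 b := by
  rw [rect, Finset.sum_product]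
  refine Finset.sum_congr rfl fun a _ => ?_
  rw [Finset.mul_sum]
  refine Finset.sum_congr rfl fun b _ => ?_
  rw [char3_apply, sample, fourier_coe_eq_cis, phase, cis_add]
  ring

lemma tendsto_sum_char3_of_ne_zero {t : ℝ} (ht : 0 < t) {k : ℝ × ℝ × ℤ} (hk : k.2.2 ≠ 0) :
    Tendsto (fun J => (numPts J : ℂ)⁻¹ * ∑ P ∈ rect J, char3 k (sample t J P)) atTop (𝓝 0) := by
  rw [tendsto_zero_iff_norm_tendsto_zero, Metric.tendsto_atTop']
  intro ε hε
  obtain ⟨M, hM⟩ := eventually_atTop.1 (eventually_norm_sum_phase_le ht k.1 hk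
    (by positivity : 0 < ε / 4))
  obtain ⟨M', hM'⟩ := exists_nat_gt (4 / ε)
  refine ⟨M + M', fun J hJ => ?_⟩
  have hJ' : (4 / ε) < J := hM'.trans (by exact_mod_cast (by omega : M' < J))
  rw [div_lt_iff₀ hε] at hJ'
  have hN : (numPts J : ℝ) = (2 * J + 1) * (J + 1) := by rw [numPts_eq]; push_cast; ring
  have hN0 : (0 : ℝ) < numPts J := by exact_mod_cast numPts_pos J
  rw [dist_zero_right, norm_norm, norm_mul, norm_inv, Complex.norm_natCast, inv_mul_lt_iff₀ hN0,
    sum_char3_sample]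
  -- The summand 1 accounts for the row `b = 0`, where the phase is a division by zero; that row
  -- carries a vanishing proportion of the points.
  have hb : ∀ a ∈ Finset.Icc (-(J : ℤ)) J, ‖cis (k.2.1 * (a / J)) *
        ∑ b ∈ Finset.Icc (0 : ℤ) J, phase t J a k.1 k.2.2 b‖ ≤ 1 + ε / 4 * J := by
    intro a ha
    rw [norm_mul, norm_cis, one_mul, sum_Icc_int J (fun b : ℤ => phase t J a k.1 k.2.2 b)]
    refine (norm_add_le _ _).trans (add_le_add ?_ ?_)
    · exact (norm_cis _).le
    · have ha' : |(a : ℝ)| ≤ J := by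
        rw [abs_le]; rw [Finset.mem_Icc] at ha; exact_mod_cast ha
      simpa using hM J (by omega) a ha'
  refine (norm_sum_le_of_le _ hb).trans_lt ?_
  rw [Finset.sum_const, Int.card_Icc, nsmul_eq_mul, hN]
  have hc : ((((J : ℤ) + 1 - -(J : ℤ)).toNat : ℕ) : ℝ) = 2 * J + 1 := by
    have : ((J : ℤ) + 1 - -(J : ℤ)).toNat = 2 * J + 1 := by omega
    rw [this]; push_cast; ring
  rw [hc, mul_assoc]
  have hJ0 : (0 : ℝ) ≤ J := Nat.cast_nonneg J
  have : 1 + ε / 4 * J < ((J : ℝ) + 1) * ε := by nlinarith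
  gcongr

lemma tendsto_avg_vertical (p : ℝ) :
    Tendsto (fun J : ℕ => ((J : ℂ) + 1)⁻¹ * ∑ b ∈ Finset.Icc (0 : ℤ) J, cis (p * (b / J))) atTop
      (𝓝 (∫ w in (0 : ℝ)..1, cis (p * w))) := by
  have hR := tendsto_riemann_sum (f := fun w => cis (p * w)) (continuous_cis.comp (by fun_prop))
  have h1 : Tendsto (fun J : ℕ => ((J : ℂ) + 1)⁻¹) atTop (𝓝 0) := by
    simpa using tendsto_one_div_add_atTop_nhds_zero_nat (𝕜 := ℂ)
  have h2 : Tendsto (fun J : ℕ => (1 : ℂ) - ((J : ℂ) + 1)⁻¹) atTop (𝓝 1) := by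
    simpa using tendsto_const_nhds.sub h1
  have h3 := h1.add (h2.mul hR)
  rw [zero_add, one_mul] at h3
  refine h3.congr' ?_
  filter_upwards [eventually_gt_atTop 0] with J hJ
  have hJ' : (J : ℂ) ≠ 0 := by exact_mod_cast hJ.ne'
  have hJ1 : (J : ℂ) + 1 ≠ 0 := by exact_mod_cast J.succ_ne_zero
  rw [sum_Icc_int J (fun b : ℤ => cis (p * (b / J)))]
  simp only [Int.cast_zero, zero_div, mul_zero, cis_zero, Complex.real_smul, Int.cast_add,
    Int.cast_natCast, Int.cast_one]
  generalize ∑ i ∈ Finset.range J, cis (p * (((i : ℝ) + 1) / J)) = S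
  push_cast
  field_simp
  ring

lemma tendsto_avg_horizontal (q : ℝ) :
    Tendsto (fun J : ℕ => (2 * (J : ℂ) + 1)⁻¹ *
      ∑ a ∈ Finset.Icc (-(J : ℤ)) J, cis (q * (a / J))) atTop
      (𝓝 ((2 : ℂ)⁻¹ * ∫ x in (-1 : ℝ)..1, cis (q * x))) := by
  have hc : Continuous fun x => cis (q * x) := continuous_cis.comp (by fun_prop)
  have hc' : Continuous fun x => cis (q * -x) := hc.comp continuous_neg
  -- The columns `a` and `-a` are paired, so that a Riemann sum on `[0, 1]` suffices.
  have hR := tendsto_riemann_sum (f := fun x => cis (q * x) + cis (q * -x))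
    (hc.add hc')
  have hI : ∫ x in (0 : ℝ)..1, (cis (q * x) + cis (q * -x)) = ∫ x in (-1 : ℝ)..1, cis (q * x) := by
    rw [intervalIntegral.integral_add (hc.intervalIntegrable _ _)
      (hc'.intervalIntegrable _ _),
      intervalIntegral.integral_comp_neg (fun x => cis (q * x)), neg_zero, add_comm,
      intervalIntegral.integral_add_adjacent_intervals (hc.intervalIntegrable _ _)
        (hc.intervalIntegrable _ _)]
  rw [hI] at hR
  have h1 : Tendsto (fun J : ℕ => (2 * (J : ℂ) + 1)⁻¹) atTop (𝓝 0) := by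
    rw [tendsto_zero_iff_norm_tendsto_zero]
    refine squeeze_zero (fun _ => norm_nonneg _) (fun J => ?_)
      (tendsto_one_div_add_atTop_nhds_zero_nat (𝕜 := ℝ))
    have : (2 * (J : ℂ) + 1) = ((2 * J + 1 : ℕ) : ℂ) := by push_cast; ring
    rw [norm_inv, this, Complex.norm_natCast, one_div]
    push_cast
    gcongr
    linarith [(Nat.cast_nonneg J : (0 : ℝ) ≤ J)]
  have h2 : Tendsto (fun J : ℕ => (2 : ℂ)⁻¹ * (1 - (2 * (J : ℂ) + 1)⁻¹)) atTop (𝓝 2⁻¹) := by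
    simpa using ((tendsto_const_nhds (x := (1 : ℂ))).sub h1).const_mul (2 : ℂ)⁻¹
  have h3 := h1.add (h2.mul hR)
  rw [zero_add] at h3
  refine h3.congr' ?_
  filter_upwards [eventually_gt_atTop 0] with J hJ
  have hJ' : (J : ℂ) ≠ 0 := by exact_mod_cast hJ.ne'
  have hJ1 : 2 * (J : ℂ) + 1 ≠ 0 := by exact_mod_cast (2 * J).succ_ne_zero
  rw [sum_Icc_neg_int J (fun b : ℤ => cis (q * (b / J)))]
  simp only [Int.cast_zero, zero_div, mul_zero, cis_zero, Complex.real_smul, Int.cast_add,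
    Int.cast_natCast, Int.cast_one, Int.cast_neg, neg_div]
  generalize ∑ i ∈ Finset.range J, (cis (q * (((i : ℝ) + 1) / J)) +
    cis (q * -(((i : ℝ) + 1) / J))) = S
  push_cast
  field_simp
  ring

lemma tendsto_integral_char3 {t : ℝ} (ht : 0 < t) (k : ℝ × ℝ × ℤ) :
    Tendsto (fun J => ∫ x, char3 k x ∂(empirical t J)) atTop
      (𝓝 (∫ x, char3 k x ∂limitMeasure)) := by
  simp only [integral_empirical, integral_char3_limitMeasure]
  by_cases hk : k.2.2 = 0
  · rw [if_pos hk, mul_one]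
    refine ((tendsto_avg_vertical k.1).mul (tendsto_avg_horizontal k.2.1)).congr fun J => ?_
    rw [sum_char3_sample]
    simp only [phase, hk, Int.cast_zero, zero_mul, add_zero]
    rw [← Finset.sum_mul, numPts_eq]
    push_cast
    rw [mul_inv]
    ring
  · rw [if_neg hk, mul_zero, mul_zero]
    exact tendsto_sum_char3_of_ne_zero ht hk

lemma tendsto_integral_trigPoly {t : ℝ} (ht : 0 < t) {g : (ℝ × ℝ × UnitAddCircle) →ᵇ ℂ}
    (hg : g ∈ trigPoly) :
    Tendsto (fun J => ∫ x, g x ∂(empirical t J)) atTop (𝓝 (∫ x, g x ∂limitMeasure)) := by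
  have hg' : g ∈ Submodule.span ℂ (Set.range char3) := by
    rw [← trigPoly_toSubmodule]; exact hg
  induction hg' using Submodule.span_induction with
  | mem x hx => obtain ⟨k, rfl⟩ := hx; exact tendsto_integral_char3 ht k
  | zero => simp
  | add x y hx hy ihx ihy =>
    have hx' : x ∈ trigPoly := by
      change x ∈ Subalgebra.toSubmodule trigPoly.toSubalgebra
      rw [trigPoly_toSubmodule]; exact hx
    have hy' : y ∈ trigPoly := by
      change y ∈ Subalgebra.toSubmodule trigPoly.toSubalgebra
      rw [trigPoly_toSubmodule]; exact hy
    have : ∀ μ : Measure (ℝ × ℝ × UnitAddCircle), IsProbabilityMeasure μ →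
        ∫ z, (x + y) z ∂μ = ∫ z, x z ∂μ + ∫ z, y z ∂μ := fun μ _ =>
      integral_add (x.integrable μ) (y.integrable μ)
    simp only [this _ inferInstance]
    exact (ihx hx').add (ihy hy')
  | smul c x hx ihx =>
    have hx' : x ∈ trigPoly := by
      change x ∈ Subalgebra.toSubmodule trigPoly.toSubalgebra
      rw [trigPoly_toSubmodule]; exact hx
    have : ∀ μ : Measure (ℝ × ℝ × UnitAddCircle), ∫ z, (c • x) z ∂μ = c * ∫ z, x z ∂μ :=
      fun μ => integral_const_mul c x
    simp only [this]
    exact (ihx hx').const_mul c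

lemma isTightMeasureSet_empirical (t : ℝ) : IsTightMeasureSet (Set.range (empirical t)) := by
  rw [isTightMeasureSet_iff_exists_isCompact_measure_compl_le]
  intro ε _
  refine ⟨Set.Icc 0 1 ×ˢ (Set.Icc (-1) 1 ×ˢ Set.univ),
    isCompact_Icc.prod (isCompact_Icc.prod isCompact_univ), ?_⟩
  rintro _ ⟨J, rfl⟩
  refine le_of_eq_of_le ?_ zero_le
  rw [empirical, Measure.smul_apply, Measure.finsetSum_apply, Finset.sum_eq_zero, smul_zero]
  intro P hP
  rw [Measure.dirac_apply' _ (by measurability), Set.indicator_of_notMem]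
  rw [Set.notMem_compl_iff]
  obtain ⟨⟨h1, h2⟩, h3, h4⟩ := cast_mem_rect hP
  rcases Nat.eq_zero_or_pos J with rfl | hJ
  · simp [sample]
  · have hJ' : (0 : ℝ) < J := by exact_mod_cast hJ
    refine ⟨⟨by simp only [sample]; positivity, ?_⟩, ⟨?_, ?_⟩, Set.mem_univ _⟩
    · simp only [sample]; rwa [div_le_one hJ']
    · simp only [sample]; rw [le_div_iff₀ hJ']; linarith
    · simp only [sample]; rwa [div_le_one hJ']

/-- `empirical` as a probability measure. -/
def empiricalProb (t : ℝ) (J : ℕ) : ProbabilityMeasure (ℝ × ℝ × UnitAddCircle) :=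
  ⟨empirical t J, inferInstance⟩

/-- `limitMeasure` as a probability measure. -/
def limitProb : ProbabilityMeasure (ℝ × ℝ × UnitAddCircle) := ⟨limitMeasure, inferInstance⟩

/-- The samples equidistribute. -/
theorem tendsto_empiricalProb {t : ℝ} (ht : 0 < t) :
    Tendsto (empiricalProb t) atTop (𝓝 limitProb) := by
  refine ProbabilityMeasure.tendsto_of_tight_of_separatesPoints ℂ (A := trigPoly)
    ?_ separatesPoints_trigPoly fun g hg => tendsto_integral_trigPoly ht hg
  exact isTightMeasureSet_empirical t

/-! ### Closed and open approximations of the gap condition -/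

/-- A closed set which contains, for large `J`, the samples of the points followed by a gap. -/
def outerSet (t lam ε : ℝ) : Set (ℝ × ℝ × UnitAddCircle) :=
  {p | ¬ (ε < p.1 ∧ p.1 < 1 - ε ∧ ∃ j : ℤ, |p.2.1 * p.1 + j * t| < (1 - ε) * p.1 ∧
    ∃ q : ℝ, q * (2 * p.1) < (lam - ε) * t ∧
      j • p.2.2 ∈ ((↑) : ℝ → UnitAddCircle) '' Set.Ioo 0 q)}

/-- An open set such that, for large `J`, its samples belong to points followed by a gap. -/
def innerSet (t lam ε : ℝ) : Set (ℝ × ℝ × UnitAddCircle) :=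
  {p | ε < p.1 ∧ (lam + ε) * t / 2 < p.1 ∧ ∀ j ∈ Finset.Icc (-⌈3 / t⌉) ⌈3 / t⌉, j ≠ 0 →
    |p.2.1 * p.1 + j * t| ≤ (1 + ε) * p.1 →
      ∀ s : ℝ, 0 ≤ s → s * (2 * p.1) ≤ (lam + ε) * t → j • p.2.2 ≠ (s : UnitAddCircle)}

lemma isClosed_outerSet (t lam ε : ℝ) : IsClosed (outerSet t lam ε) := by
  rw [← isOpen_compl_iff]
  have : (outerSet t lam ε)ᶜ = {p | ε < p.1} ∩ ({p | p.1 < 1 - ε} ∩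
      ⋃ j : ℤ, ({p | |p.2.1 * p.1 + j * t| < (1 - ε) * p.1} ∩
        ⋃ q : ℝ, ({p | q * (2 * p.1) < (lam - ε) * t} ∩
          (fun p : ℝ × ℝ × UnitAddCircle => j • p.2.2) ⁻¹'
            (((↑) : ℝ → UnitAddCircle) '' Set.Ioo 0 q)))) := by
    ext p
    simp only [outerSet, Set.mem_compl_iff, Set.mem_ofPred_eq, not_not, Set.mem_inter_iff,
      Set.mem_iUnion, Set.mem_preimage]
  rw [this]
  refine (isOpen_lt (by fun_prop) (by fun_prop)).inter
    ((isOpen_lt (by fun_prop) (by fun_prop)).inter (isOpen_iUnion fun j =>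
      (isOpen_lt (by fun_prop) (by fun_prop)).inter (isOpen_iUnion fun q =>
        (isOpen_lt (by fun_prop) (by fun_prop)).inter ?_)))
  refine IsOpen.preimage (by fun_prop) ?_
  exact QuotientAddGroup.isOpenMap_coe _ isOpen_Ioo

/-- Each forbidden set asks for some `s`; since `w ≥ ε`, this `s` stays in a fixed compact interval,
and projecting a closed set along a compact factor gives a closed set. Only finitely many `j` are
involved. -/
lemma isOpen_innerSet (t lam : ℝ) {ε : ℝ} (hε : 0 < ε) : IsOpen (innerSet t lam ε) := by
  have hC : ∀ j : ℤ, IsClosed {p : ℝ × ℝ × UnitAddCircle | ε ≤ p.1 ∧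
      |p.2.1 * p.1 + j * t| ≤ (1 + ε) * p.1 ∧
      ∃ s : ℝ, 0 ≤ s ∧ s * (2 * p.1) ≤ (lam + ε) * t ∧ j • p.2.2 = (s : UnitAddCircle)} := by
    intro j
    have hZ : IsClosed {x : Set.Icc 0 ((lam + ε) * t / (2 * ε)) × (ℝ × ℝ × UnitAddCircle) |
        ε ≤ x.2.1 ∧ |x.2.2.1 * x.2.1 + j * t| ≤ (1 + ε) * x.2.1 ∧
        (x.1 : ℝ) * (2 * x.2.1) ≤ (lam + ε) * t ∧
          j • x.2.2.2 = ((x.1 : ℝ) : UnitAddCircle)} := by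
      have h1 : IsClosed {x : Set.Icc 0 ((lam + ε) * t / (2 * ε)) × (ℝ × ℝ × UnitAddCircle) |
          ε ≤ x.2.1} := isClosed_le (by fun_prop) (by fun_prop)
      have h2 : IsClosed {x : Set.Icc 0 ((lam + ε) * t / (2 * ε)) × (ℝ × ℝ × UnitAddCircle) |
          |x.2.2.1 * x.2.1 + j * t| ≤ (1 + ε) * x.2.1} := isClosed_le (by fun_prop) (by fun_prop)
      have h3 : IsClosed {x : Set.Icc 0 ((lam + ε) * t / (2 * ε)) × (ℝ × ℝ × UnitAddCircle) |
          (x.1 : ℝ) * (2 * x.2.1) ≤ (lam + ε) * t} := isClosed_le (by fun_prop) (by fun_prop)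
      have h4 : IsClosed {x : Set.Icc 0 ((lam + ε) * t / (2 * ε)) × (ℝ × ℝ × UnitAddCircle) |
          j • x.2.2.2 = ((x.1 : ℝ) : UnitAddCircle)} :=
        isClosed_eq (by fun_prop) ((AddCircle.continuous_mk' 1).comp (by fun_prop))
      exact h1.inter (h2.inter (h3.inter h4))
    convert! isClosedMap_snd_of_compactSpace _ hZ using 1
    ext p
    simp only [Set.mem_ofPred_eq, Set.mem_image, Prod.exists]
    constructor
    · rintro ⟨h1, h2, s, h3, h4, h5⟩
      refine ⟨⟨s, h3, ?_⟩, p.1, p.2.1, p.2.2, ⟨h1, h2, h4, h5⟩, rfl⟩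
      rw [le_div_iff₀ (by positivity)]
      refine le_trans ?_ h4
      gcongr
    · rintro ⟨s, w, x, z, ⟨h1, h2, h4, h5⟩, rfl⟩
      exact ⟨h1, h2, s, s.2.1, h4, h5⟩
  have : innerSet t lam ε = {p | ε < p.1} ∩ ({p | (lam + ε) * t / 2 < p.1} ∩
      ⋂ j ∈ (Finset.Icc (-⌈3 / t⌉) ⌈3 / t⌉).filter (· ≠ 0),
        {p : ℝ × ℝ × UnitAddCircle | ε ≤ p.1 ∧
      |p.2.1 * p.1 + j * t| ≤ (1 + ε) * p.1 ∧
      ∃ s : ℝ, 0 ≤ s ∧ s * (2 * p.1) ≤ (lam + ε) * t ∧ j • p.2.2 = (s : UnitAddCircle)}ᶜ) := by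
    ext p
    simp only [innerSet, Set.mem_ofPred_eq, Set.mem_inter_iff, Set.mem_iInter, Set.mem_compl_iff,
      Finset.mem_filter]
    refine and_congr_right fun h1 => and_congr_right fun h2 => ?_
    constructor
    · rintro h j ⟨hj, hj0⟩ ⟨-, h3, s, h4, h5, h6⟩
      exact h j hj hj0 h3 s h4 h5 h6
    · intro h j hj hj0 h3 s h4 h5 h6
      exact h j ⟨hj, hj0⟩ ⟨h1.le, h3, s, h4, h5, h6⟩
  rw [this]
  exact (isOpen_lt (by fun_prop) (by fun_prop)).inter
    ((isOpen_lt (by fun_prop) (by fun_prop)).inter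
      (isOpen_biInter_finset fun j _ => (hC j).isOpen_compl))

lemma coe_eq_coe_iff {x y : ℝ} :
    (x : UnitAddCircle) = (y : UnitAddCircle) ↔ ∃ m : ℤ, x - y = m := by
  rw [← sub_eq_zero, ← AddCircle.coe_sub, AddCircle.coe_eq_zero_iff]
  simp [eq_comm]

lemma abs_le_div_of_abs_add_le {t w x j C : ℝ} (ht : 0 < t) (hw0 : 0 < w) (hw1 : w ≤ 1)
    (hx : |x| ≤ 1) (h : |x * w + j * t| ≤ C) : |j| ≤ (C + 1) / t := by
  rw [le_div_iff₀ ht, show |j| * t = |j * t| by rw [abs_mul, abs_of_pos ht]]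
  have h1 : j * t = (x * w + j * t) - x * w := by ring
  rw [h1]
  have h2 : |x * w| ≤ 1 := by
    rw [abs_mul, abs_of_pos hw0]; exact mul_le_one₀ hx hw0.le hw1
  exact (abs_sub _ _).trans (add_le_add h h2)

/-- The link between angles and phases: for the offset `(m, j)` the determinant collapses to `b·s`,
so the angular distance depends on `w` and on a lift `s` of `jz` only. -/
lemma slopeDiff_eq_of_eq {t w x s : ℝ} {J : ℕ} {a b m j : ℤ} (ht : 0 < t) (hJ : (0 : ℝ) < J)
    (hw : 0 < w) (ha : (a : ℝ) = x * J) (hb : (b : ℝ) = w * J)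
    (hm : (m : ℝ) = j * ((t * (J : ℝ) ^ 2 + a) / b) - s) :
    slopeDiff t J (a, b) (a + m, b + j) = 2 * w * s / t := by
  rw [slopeDiff]
  push_cast
  rw [hm, hb, ha]
  field_simp
  ring

/-- Outside the closed set there are `j` and a small `s > 0` congruent to `jz`. Then `m = j(T + a)/b
- s` is an integer, and `(a + m, b + j)` is a point of the rectangle that would fall inside the gap.
-/
lemma eventually_mem_outerSet {t : ℝ} (ht : 0 < t) (lam : ℝ) (hlam : 0 < lam) {ε : ℝ}
    (hε : 0 < ε) :
    ∀ᶠ J : ℕ in atTop, ∀ P ∈ rect J,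
      (∀ Q ∈ rect J, ¬ (viewAngle t J P < viewAngle t J Q ∧
        viewAngle t J Q < viewAngle t J P + lam * avgGap t J)) →
      sample t J P ∈ outerSet t lam ε := by
  obtain ⟨c₁, c₂, -, hc₂, hc⟩ := exists_slopeDiff_bounds ht
  have hlim : ∀ᶠ J : ℕ in atTop,
      c₂ J * (lam - ε) < lam * (2 * t * (J : ℝ) ^ 3 * avgGap t J) :=
    (hc₂.mul_const (lam - ε)).eventually_lt ((tendsto_mul_avgGap ht).const_mul lam)
      (by linarith)
  -- Here `2/t` bounds `|j|`, `2/t/ε` bounds `|jx/w|`, and `λt/(2ε)` bounds `s`; each must fit into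
  -- the margin `εJ` to the boundary of the rectangle.
  have hlarge : ∀ᶠ J : ℕ in atTop, 2 / t / ε + (2 / t / ε + lam * t / (2 * ε)) / ε < J :=
    tendsto_natCast_atTop_atTop.eventually_gt_atTop _
  filter_upwards [hc, hlim, hlarge] with J hcJ hlimJ hJ P hP hgap
  obtain ⟨hc₁pos, hc₂pos, hcJ⟩ := hcJ
  have hJ' : (0 : ℝ) < J := lt_of_le_of_lt (by positivity) hJ
  have hJ1 : 2 / t / ε < J := lt_of_le_of_lt (le_add_of_nonneg_right (by positivity)) hJ
  have hJ2 : (2 / t / ε + lam * t / (2 * ε)) / ε < J :=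
    lt_of_le_of_lt (le_add_of_nonneg_left (by positivity)) hJ
  rw [div_lt_iff₀ hε] at hJ1 hJ2
  obtain ⟨⟨hP1, hP2⟩, hP3, hP4⟩ := cast_mem_rect hP
  rintro ⟨hw1, hw2, j, hj, q, hq, s, hs, hjs⟩
  simp only [sample] at hw1 hw2 hj hq hjs
  have hbpos : (0 : ℝ) < P.2 := by
    rw [lt_div_iff₀ hJ'] at hw1
    exact (mul_pos hε hJ').trans hw1
  rw [← AddCircle.coe_zsmul, eq_comm, coe_eq_coe_iff] at hjs
  obtain ⟨m, hm⟩ := hjs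
  obtain ⟨a, b⟩ := P
  simp only at *
  have hab : |(a : ℝ)| ≤ J := abs_le.2 ⟨hP1, hP2⟩
  set w : ℝ := (b : ℝ) / J with hw
  have hw0 : 0 < w := by positivity
  have hw1' : w ≤ 1 := by rw [hw, div_le_one hJ']; exact hP4
  have hbw : (b : ℝ) = w * J := by rw [hw]; field_simp
  have hx : |(a : ℝ) / J| ≤ 1 := by rw [abs_div, abs_of_pos hJ', div_le_one hJ']; exact hab
  set x : ℝ := (a : ℝ) / J with hxdef
  have hax : (a : ℝ) = x * J := by rw [hxdef]; field_simp
  have hjt : |(j : ℝ)| ≤ 2 / t := by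
    have h1 : (1 - ε) * w ≤ 1 := by nlinarith
    refine (abs_le_div_of_abs_add_le ht hw0 hw1' hx (hj.le.trans h1)).trans (le_of_eq ?_)
    norm_num
  have hs1 : s ≤ lam * t / (2 * ε) := by
    have hs0 := hs.1
    have hsq : s < q := hs.2
    rw [le_div_iff₀ (by positivity)]
    have : s * (2 * ε) ≤ q * (2 * w) := mul_le_mul hsq.le (by linarith) (by positivity) (by linarith)
    nlinarith
  have hz : (j : ℝ) * ((t * (J : ℝ) ^ 2 + a) / b) = j * t * J / w + j * x / w := by
    rw [hbw, hax]; field_simp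
  rw [zsmul_eq_mul, hz] at hm
  have hQ : (a + m, b + j) ∈ rect J := by
    rw [mem_rect]
    have h1 : |((a + m : ℤ) : ℝ)| ≤ J := by
      have e1 : ((a + m : ℤ) : ℝ) = J * ((x * w + j * t) / w) + (j * x / w - s) := by
        push_cast; rw [← hm, hax]; field_simp; ring
      rw [e1]
      refine (abs_add_le _ _).trans ?_
      have h2 : |J * ((x * w + j * t) / w)| ≤ J * (1 - ε) := by
        rw [abs_mul, abs_div, abs_of_pos hJ', abs_of_pos hw0]
        gcongr
        rw [div_le_iff₀ hw0]; exact hj.le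
      have h3 : |j * x / w - s| ≤ 2 / t / ε + lam * t / (2 * ε) := by
        refine (abs_sub _ _).trans (add_le_add ?_ ?_)
        · rw [abs_div, abs_mul, abs_of_pos hw0]
          have : |(j : ℝ)| * |x| ≤ 2 / t := by
            calc |(j : ℝ)| * |x| ≤ 2 / t * 1 := by gcongr
              _ = _ := mul_one _
          gcongr
        · rw [abs_of_pos hs.1]; exact hs1
      linarith
    have h2 := abs_le.1 h1
    have hjε : |(j : ℝ)| < ε * J := by linarith
    have h3 := abs_lt.1 hjε
    have h4 : ε * J ≤ b := by rw [hbw]; gcongr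
    have h5 : (b : ℝ) ≤ (1 - ε) * J := by rw [hbw]; gcongr
    refine ⟨⟨by exact_mod_cast h2.1, by exact_mod_cast h2.2⟩, ?_, ?_⟩
    · have : (0 : ℝ) ≤ ((b + j : ℤ) : ℝ) := by push_cast; linarith
      exact_mod_cast this
    · have : ((b + j : ℤ) : ℝ) ≤ ((J : ℤ) : ℝ) := by push_cast; linarith
      exact_mod_cast this
  have hD : slopeDiff t J (a, b) (a + m, b + j) = 2 * w * s / t := 
    slopeDiff_eq_of_eq ht hJ' hw0 hax hbw (by rw [hz, hm])
  have hDpos : 0 < slopeDiff t J (a, b) (a + m, b + j) := by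
    rw [hD]; have := hs.1; positivity
  have hDlt : slopeDiff t J (a, b) (a + m, b + j) < lam - ε := by
    rw [hD, div_lt_iff₀ ht]
    refine lt_of_le_of_lt ?_ hq
    have : s ≤ q := hs.2.le
    calc 2 * w * s = s * (2 * w) := by ring
      _ ≤ _ := by gcongr
  obtain ⟨hlow, hup⟩ := hcJ _ hP _ hQ hDpos.le
  have hJ3 : 0 < 2 * t * (J : ℝ) ^ 3 := by positivity
  refine hgap _ hQ ⟨?_, ?_⟩
  · have := lt_of_lt_of_le (mul_pos hc₁pos hDpos) hlow
    have := pos_of_mul_pos_right this hJ3.le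
    linarith
  · have h1 : 2 * t * (J : ℝ) ^ 3 * (viewAngle t J (a + m, b + j) - viewAngle t J (a, b)) <
        2 * t * (J : ℝ) ^ 3 * (lam * avgGap t J) := by
      refine hup.trans_lt ((mul_lt_mul_of_pos_left hDlt hc₂pos).trans (hlimJ.trans_le ?_))
      apply le_of_eq; ring
    have := lt_of_mul_lt_mul_left h1 hJ3.le
    linarith

-- Conversely, a point `Q ≠ P` inside the window yields `s ≥ 0` with `2ws < (λ + ε)t` and `s`
-- congruent to `jz`. If `j = 0`, then `s` is an integer below 1, which forces `Q = P`; if `j ≠ 0`,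
-- then row `j` is nearly visible and the open condition is violated.
set_option maxHeartbeats 400000 in
lemma eventually_of_mem_innerSet {t : ℝ} (ht : 0 < t) (lam : ℝ) (hlam : 0 < lam) {ε : ℝ}
    (hε : 0 < ε) (hε1 : ε ≤ 1) :
    ∀ᶠ J : ℕ in atTop, ∀ P ∈ rect J, sample t J P ∈ innerSet t lam ε →
      ∀ Q ∈ rect J, Q ≠ P → ¬ (viewAngle t J P ≤ viewAngle t J Q ∧
        viewAngle t J Q < viewAngle t J P + lam * avgGap t J) := by
  obtain ⟨c₁, c₂, hc₁, -, hc⟩ := exists_slopeDiff_bounds ht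
  have hlim : ∀ᶠ J : ℕ in atTop,
      lam * (2 * t * (J : ℝ) ^ 3 * avgGap t J) < c₁ J * (lam + ε) :=
    ((tendsto_mul_avgGap ht).const_mul lam).eventually_lt (hc₁.mul_const (lam + ε))
      (by linarith)
  set B := (lam + 1) * t / (2 * ε) with hB
  have hlarge : ∀ᶠ J : ℕ in atTop, ((4 + 2 * B) / t / ε + B) / ε < J :=
    tendsto_natCast_atTop_atTop.eventually_gt_atTop _
  filter_upwards [hc, hlim, hlarge, eventually_two_lt_mul ht] with
    J hcJ hlimJ hJ hJt P hP hin Q hQ hne hgap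
  obtain ⟨hc₁pos, hc₂pos, hcJ⟩ := hcJ
  have hB0 : 0 < B := by positivity
  have hJ' : (0 : ℝ) < J := by exact_mod_cast hJt.1
  have hJ1 : (1 : ℝ) ≤ J := by exact_mod_cast hJt.1
  rw [div_lt_iff₀ hε] at hJ
  have hJ3 : 0 < 2 * t * (J : ℝ) ^ 3 := by positivity
  have hD0 : 0 ≤ slopeDiff t J P Q := by
    by_contra! hneg
    have hpos : 0 < slopeDiff t J Q P := by rw [slopeDiff_swap]; linarith
    have h1 := (hcJ _ hQ _ hP hpos.le).1
    have := lt_of_lt_of_le (mul_pos hc₁pos hpos) h1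
    have := pos_of_mul_pos_right this hJ3.le
    linarith [hgap.1]
  have hDlt : slopeDiff t J P Q < lam + ε := by
    have h1 := (hcJ _ hP _ hQ hD0).1
    have h2 : 2 * t * (J : ℝ) ^ 3 * (viewAngle t J Q - viewAngle t J P) <
        2 * t * (J : ℝ) ^ 3 * (lam * avgGap t J) := by
      apply mul_lt_mul_of_pos_left _ hJ3
      linarith [hgap.2]
    have h3 : c₁ J * slopeDiff t J P Q < c₁ J * (lam + ε) := by
      refine h1.trans_lt (h2.trans_le (le_trans (le_of_eq ?_) hlimJ.le))
      ring
    exact lt_of_mul_lt_mul_left h3 hc₁pos.le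
  obtain ⟨⟨hP1, hP2⟩, hP3, hP4⟩ := cast_mem_rect hP
  obtain ⟨⟨hQ1, hQ2⟩, hQ3, hQ4⟩ := cast_mem_rect hQ
  obtain ⟨hw1, hw2, hall⟩ := hin
  simp only [sample] at hw1 hw2 hall
  obtain ⟨a, b⟩ := P
  obtain ⟨a', b'⟩ := Q
  obtain ⟨m, rfl⟩ : ∃ m, a' = a + m := ⟨a' - a, by ring⟩
  obtain ⟨j, rfl⟩ : ∃ j, b' = b + j := ⟨b' - b, by ring⟩
  simp only at *
  have hbpos : (0 : ℝ) < b := by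
    rw [lt_div_iff₀ hJ'] at hw1
    exact (mul_pos hε hJ').trans hw1
  have hab : |(a : ℝ)| ≤ J := abs_le.2 ⟨hP1, hP2⟩
  have hab' : |((a + m : ℤ) : ℝ)| ≤ J := abs_le.2 ⟨hQ1, hQ2⟩
  set w : ℝ := (b : ℝ) / J with hw
  have hw0 : 0 < w := by positivity
  have hw1' : w ≤ 1 := by rw [hw, div_le_one hJ']; exact hP4
  have hbw : (b : ℝ) = w * J := by rw [hw]; field_simp
  have hx : |(a : ℝ) / J| ≤ 1 := by rw [abs_div, abs_of_pos hJ', div_le_one hJ']; exact hab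
  set x : ℝ := (a : ℝ) / J with hxdef
  have hax : (a : ℝ) = x * J := by rw [hxdef]; field_simp
  obtain ⟨s, hs⟩ : ∃ s, s = (j : ℝ) * ((t * (J : ℝ) ^ 2 + a) / b) - m := ⟨_, rfl⟩
  have hD : slopeDiff t J (a, b) (a + m, b + j) = 2 * w * s / t := 
    slopeDiff_eq_of_eq ht hJ' hw0 hax hbw (by rw [hs]; ring)
  rw [hD] at hD0 hDlt
  have hs0 : 0 ≤ s := by
    have h1 : 2 * w * s / t = 2 * w / t * s := by ring
    rw [h1] at hD0
    exact nonneg_of_mul_nonneg_right hD0 (by positivity)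
  have hs2 : s * (2 * w) < (lam + ε) * t := by
    rw [div_lt_iff₀ ht] at hDlt; linarith
  by_cases hj : j = 0
  · subst hj
    have h1 : s = ((-m : ℤ) : ℝ) := by rw [hs]; push_cast; ring
    have h2 : s < 1 := by
      have : s * (2 * w) < 1 * (2 * w) := by linarith
      exact lt_of_mul_lt_mul_right this (by positivity)
    rw [h1] at h2 hs0
    have h3 : -m < 1 := by exact_mod_cast h2
    have h4 : 0 ≤ -m := by exact_mod_cast hs0
    obtain rfl : m = 0 := by omega
    exact hne (by simp)
  · have hsB : s ≤ B := by
      rw [hB, le_div_iff₀ (by positivity)]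
      have : s * (2 * ε) ≤ s * (2 * w) := by gcongr
      have : (lam + ε) * t ≤ (lam + 1) * t := by gcongr
      linarith
    -- The real lift of `z` is of order `J`, while `|m| ≤ 2J`; this is what first bounds `j`
    -- independently of `J`.
    have hz : t * J / 2 ≤ (t * (J : ℝ) ^ 2 + a) / b := by
      rw [le_div_iff₀ hbpos]
      have : t * J / 2 * b ≤ t * J / 2 * J := by gcongr
      nlinarith
    have hm : |(m : ℝ)| ≤ 2 * J := by
      have : (m : ℝ) = ((a + m : ℤ) : ℝ) - a := by push_cast; ring
      rw [this]
      exact (abs_sub _ _).trans (by linarith)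
    have hj0 : |(j : ℝ)| ≤ (4 + 2 * B) / t := by
      have h1 : |(j : ℝ)| * (t * J / 2) ≤ 2 * J + B := by
        calc |(j : ℝ)| * (t * J / 2) ≤ |(j : ℝ)| * ((t * (J : ℝ) ^ 2 + a) / b) := by gcongr
          _ = |(m : ℝ) + s| := by
            rw [hs, add_sub_cancel, abs_mul,
              abs_of_pos (lt_of_lt_of_le (by positivity) hz)]
          _ ≤ |(m : ℝ)| + |s| := abs_add_le _ _
          _ ≤ 2 * J + B := by rw [abs_of_nonneg hs0]; linarith
      rw [le_div_iff₀ ht]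
      have h2 : |(j : ℝ)| * t * J ≤ (4 + 2 * B) * J := by nlinarith
      exact le_of_mul_le_mul_right h2 hJ'
    have hxw : |x * w + j * t| ≤ (1 + ε) * w := by
      have e1 : x * w + j * t = (((a + m : ℤ) : ℝ) - (j * x / w - s)) / J * w := by
        push_cast; rw [hs, hax, hbw]; field_simp; ring
      rw [e1, abs_mul, abs_of_pos hw0, abs_div, abs_of_pos hJ']
      refine mul_le_mul_of_nonneg_right ?_ hw0.le
      rw [div_le_iff₀ hJ']
      refine (abs_sub _ _).trans ?_
      have h3 : |j * x / w - s| ≤ (4 + 2 * B) / t / ε + B := by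
        refine (abs_sub _ _).trans (add_le_add ?_ ?_)
        · rw [abs_div, abs_mul, abs_of_pos hw0]
          have : |(j : ℝ)| * |x| ≤ (4 + 2 * B) / t := by
            calc |(j : ℝ)| * |x| ≤ (4 + 2 * B) / t * 1 := by gcongr
              _ = _ := mul_one _
          gcongr
        · rw [abs_of_nonneg hs0]; exact hsB
      linarith
    -- Now that row `j` is known to be nearly visible, the crude bound improves to the range of `j`
    -- built into `innerSet`.
    have hjt : |(j : ℝ)| ≤ 3 / t := by
      have h1 : (1 + ε) * w ≤ 2 := by nlinarith
      refine (abs_le_div_of_abs_add_le ht hw0 hw1' hx (hxw.trans h1)).trans (le_of_eq ?_)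
      norm_num
    have hjc : |j| ≤ ⌈3 / t⌉ := by
      have : ((|j| : ℤ) : ℝ) ≤ (⌈3 / t⌉ : ℤ) := by
        push_cast
        exact hjt.trans (Int.le_ceil _)
      exact_mod_cast this
    refine hall j (Finset.mem_Icc.2 (abs_le.1 hjc)) hj hxw s hs0 hs2.le ?_
    rw [← AddCircle.coe_zsmul, coe_eq_coe_iff]
    exact ⟨m, by rw [hs, zsmul_eq_mul]; ring⟩

/-! ### The limiting pieces and generic points -/

/-- The phases `z` such that, in the row of height `w`, none of the rows `j` with `-k ≤ j ≤ r`,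
`j ≠ 0`, has a point closely after the given one. -/
def goodPhase (t lam : ℝ) (k r : ℕ) (w : ℝ) : Set UnitAddCircle :=
  {z | ∀ j : ℤ, -(k : ℤ) ≤ j → j ≤ r → j ≠ 0 → j • z ≠ 0 ∧
    ∀ q : ℝ, q * (2 * w) < lam * t → j • z ∉ ((↑) : ℝ → UnitAddCircle) '' Set.Ioo 0 q}

/-- The region on which `k` rows below and `r` rows above are visible and a gap follows. -/
def piece (t lam : ℝ) (k r : ℕ) : Set (ℝ × ℝ × UnitAddCircle) :=
  {p | (lam * t / 2 < p.1 ∧ p.1 < 1) ∧ (k * t < (p.2.1 + 1) * p.1 ∧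
    (p.2.1 + 1) * p.1 < (k + 1) * t) ∧ (r * t < (1 - p.2.1) * p.1 ∧
    (1 - p.2.1) * p.1 < (r + 1) * t) ∧ p.2.2 ∈ goodPhase t lam k r p.1}

lemma measurableSet_goodPhase_prod (t lam : ℝ) (k r : ℕ) :
    MeasurableSet {p : ℝ × UnitAddCircle | p.2 ∈ goodPhase t lam k r p.1} := by
  have : {p : ℝ × UnitAddCircle | p.2 ∈ goodPhase t lam k r p.1} =
      ⋂ j : ℤ, ⋂ _ : -(k : ℤ) ≤ j, ⋂ _ : j ≤ r, ⋂ _ : j ≠ 0,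
        ((fun p : ℝ × UnitAddCircle => j • p.2) ⁻¹' {0})ᶜ ∩
        (⋃ q : ℝ, ({p : ℝ × UnitAddCircle | q * (2 * p.1) < lam * t} ∩
          (fun p : ℝ × UnitAddCircle => j • p.2) ⁻¹'
            (((↑) : ℝ → UnitAddCircle) '' Set.Ioo 0 q)))ᶜ := by
    ext p
    simp only [goodPhase, Set.mem_ofPred_eq, Set.mem_iInter, Set.mem_inter_iff, Set.mem_compl_iff,
      Set.mem_preimage, Set.mem_singleton_iff, Set.mem_iUnion, not_exists, not_and, ne_eq]
  rw [this]
  refine MeasurableSet.iInter fun j => MeasurableSet.iInter fun _ => MeasurableSet.iInter fun _ =>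
    MeasurableSet.iInter fun _ => MeasurableSet.inter ?_ ?_
  · exact (isClosed_singleton.preimage (by fun_prop)).measurableSet.compl
  · refine (IsOpen.measurableSet (isOpen_iUnion fun q => ?_)).compl
    refine (isOpen_lt (by fun_prop) (by fun_prop)).inter (IsOpen.preimage (by fun_prop) ?_)
    exact QuotientAddGroup.isOpenMap_coe _ isOpen_Ioo

lemma measurableSet_goodPhase (t lam : ℝ) (k r : ℕ) (w : ℝ) :
    MeasurableSet (goodPhase t lam k r w) :=
  measurable_prodMk_left (x := w) (measurableSet_goodPhase_prod t lam k r)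

lemma measurableSet_piece (t lam : ℝ) (k r : ℕ) : MeasurableSet (piece t lam k r) := by
  have h : MeasurableSet {p : ℝ × ℝ × UnitAddCircle | p.2.2 ∈ goodPhase t lam k r p.1} :=
    (measurable_fst.prodMk (measurable_snd.comp measurable_snd))
      (measurableSet_goodPhase_prod t lam k r)
  have hlt : ∀ {f g f' g' : ℝ × ℝ × UnitAddCircle → ℝ}, Continuous f → Continuous g →
      Continuous f' → Continuous g' → MeasurableSet {p | f p < g p ∧ f' p < g' p} :=
    fun hf hg hf' hg' => ((isOpen_lt hf hg).inter (isOpen_lt hf' hg')).measurableSet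
  have h1 : MeasurableSet {p : ℝ × ℝ × UnitAddCircle | lam * t / 2 < p.1 ∧ p.1 < 1} :=
    hlt (by fun_prop) (by fun_prop) (by fun_prop) (by fun_prop)
  have h2 : MeasurableSet {p : ℝ × ℝ × UnitAddCircle | k * t < (p.2.1 + 1) * p.1 ∧
      (p.2.1 + 1) * p.1 < (k + 1) * t} :=
    hlt (by fun_prop) (by fun_prop) (by fun_prop) (by fun_prop)
  have h3 : MeasurableSet {p : ℝ × ℝ × UnitAddCircle | r * t < (1 - p.2.1) * p.1 ∧
      (1 - p.2.1) * p.1 < (r + 1) * t} :=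
    hlt (by fun_prop) (by fun_prop) (by fun_prop) (by fun_prop)
  exact h1.inter (h2.inter (h3.inter h))

lemma pairwise_disjoint_piece {t : ℝ} (ht : 0 < t) (lam : ℝ) {p q : ℕ × ℕ} (h : p ≠ q) :
    Disjoint (piece t lam p.1 p.2) (piece t lam q.1 q.2) := by
  rw [Set.disjoint_left]
  rintro x ⟨-, ⟨h1, h2⟩, ⟨h3, h4⟩, -⟩ ⟨-, ⟨h5, h6⟩, ⟨h7, h8⟩, -⟩
  have aux : ∀ {a b : ℕ} {u : ℝ}, (a : ℝ) * t < u → u < ((b : ℝ) + 1) * t → a ≤ b := by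
    intro a b u ha hb
    have := lt_of_mul_lt_mul_right (ha.trans hb) ht.le
    have : a < b + 1 := by exact_mod_cast this
    omega
  exact h (Prod.ext (le_antisymm (aux h1 h6) (aux h5 h2)) (le_antisymm (aux h3 h8) (aux h7 h4)))

/-- Adding the inequalities for `(1 + x)w` and `(1 - x)w` gives `(k + r)t < 2w < (k + r + 2)t`, and
each of the two quantities is below 2. -/
lemma mem_pairs_of_mem_piece {t lam : ℝ} (ht : 0 < t) (hlam : 0 < lam) {k r : ℕ}
    {p : ℝ × ℝ × UnitAddCircle} (hp : p ∈ piece t lam k r) : (k, r) ∈ pairs t lam := by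
  obtain ⟨⟨h1, h2⟩, ⟨h3, h4⟩, ⟨h5, h6⟩, -⟩ := hp
  have hw : 0 < p.1 := lt_trans (by positivity) h1
  have hk : 0 ≤ (k : ℝ) * t := by positivity
  have hr : 0 ≤ (r : ℝ) * t := by positivity
  have hle : ∀ n : ℕ, (n : ℝ) * t ≤ 2 → n < ⌊2 / t⌋₊ + 1 := by
    intro n hn
    rw [Nat.lt_succ_iff, Nat.le_floor_iff (by positivity), le_div_iff₀ ht]
    exact hn
  rw [pairs, Finset.mem_filter, Finset.mem_product, Finset.mem_range, Finset.mem_range]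
  refine ⟨⟨hle k (by nlinarith), hle r (by nlinarith)⟩, ?_⟩
  simp only [Mminus, Mplus]
  refine max_le (le_min ?_ ?_) (le_min ?_ ?_) <;> nlinarith

lemma volume_zsmul_eq {j : ℤ} (hj : j ≠ 0) (c : UnitAddCircle) :
    volume {z : UnitAddCircle | j • z = c} = 0 := by
  obtain ⟨c, rfl⟩ := QuotientAddGroup.mk_surjective c
  have hm : MeasurableSet {z : UnitAddCircle | j • z = (c : UnitAddCircle)} :=
    (isClosed_eq (by fun_prop) continuous_const).measurableSet
  rw [← (UnitAddCircle.measurePreserving_mk 0).measure_preimage hm.nullMeasurableSet]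
  refine measure_mono_null ?_ (Set.Countable.measure_zero (s := Set.range
    (fun m : ℤ => ((m : ℝ) + c) / j)) (Set.countable_range _) _)
  intro z hz
  have hz : j • (z : UnitAddCircle) = (c : UnitAddCircle) := hz
  rw [← AddCircle.coe_zsmul, coe_eq_coe_iff] at hz
  obtain ⟨m, hm⟩ := hz
  have : (j : ℝ) ≠ 0 := by exact_mod_cast hj
  refine ⟨m, ?_⟩
  simp only
  rw [div_eq_iff this, ← hm, zsmul_eq_mul]
  ring

lemma ae_ne_of_smul_restrict (c : ℝ) :
    ∀ᵐ x ∂((2 : ℝ≥0∞)⁻¹ • volume.restrict (Set.Icc (-1 : ℝ) 1)), x ≠ c := by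
  refine Measure.ae_smul_measure (ae_restrict_of_ae ?_) _
  exact measure_eq_zero_iff_ae_notMem.1 (measure_singleton c)

/-- Almost every point is generic. -/
lemma ae_generic (t lam : ℝ) : ∀ᵐ p ∂limitMeasure,
    ((0 < p.1 ∧ p.1 < 1 ∧ p.1 ≠ lam * t / 2) ∧ |p.2.1| ≤ 1) ∧
    (∀ j : ℤ, p.2.1 * p.1 + j * t ≠ p.1 ∧ p.2.1 * p.1 + j * t ≠ -p.1) ∧
    ∀ j : ℤ, j ≠ 0 → j • p.2.2 ≠ 0 ∧ j • p.2.2 ≠ ((lam * t / (2 * p.1) : ℝ) : UnitAddCircle) := by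
  have hw : ∀ᵐ w ∂(volume.restrict (Set.Icc (0 : ℝ) 1)),
      0 < w ∧ w < 1 ∧ w ≠ lam * t / 2 := by
    rw [ae_restrict_iff' measurableSet_Icc]
    have h := fun c : ℝ => measure_eq_zero_iff_ae_notMem.1 (measure_singleton (μ := volume) c)
    filter_upwards [h 0, h 1, h (lam * t / 2)] with w h0 h1 h2 hw
    exact ⟨lt_of_le_of_ne hw.1 (Ne.symm h0), lt_of_le_of_ne hw.2 h1, h2⟩
  have hx : ∀ᵐ x ∂((2 : ℝ≥0∞)⁻¹ • volume.restrict (Set.Icc (-1 : ℝ) 1)), |x| ≤ 1 := by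
    refine Measure.ae_smul_measure ?_ _
    filter_upwards [ae_restrict_mem measurableSet_Icc] with x hx using abs_le.2 hx
  have hw' : ∀ᵐ p ∂limitMeasure, 0 < p.1 ∧ p.1 < 1 ∧ p.1 ≠ lam * t / 2 :=
    Measure.quasiMeasurePreserving_fst.ae hw
  have hx' : ∀ᵐ p ∂limitMeasure, |p.2.1| ≤ 1 :=
    (Measure.quasiMeasurePreserving_fst.comp Measure.quasiMeasurePreserving_snd).ae hx
  have hline : ∀ (j : ℤ) (σ : ℝ), ∀ᵐ p ∂limitMeasure, p.2.1 * p.1 + j * t ≠ σ * p.1 := by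
    intro j σ
    have hm : MeasurableSet {p : ℝ × ℝ × UnitAddCircle | p.2.1 * p.1 + j * t ≠ σ * p.1} :=
      (isOpen_ne_fun (by fun_prop) (by fun_prop)).measurableSet
    rw [limitMeasure, Measure.ae_prod_iff_ae_ae hm]
    filter_upwards [hw] with w hw
    filter_upwards [Measure.quasiMeasurePreserving_fst.ae
      (ae_ne_of_smul_restrict ((σ * w - j * t) / w))] with x hx h
    apply hx
    rw [eq_div_iff hw.1.ne']
    linarith
  have hz : ∀ j : ℤ, j ≠ 0 → ∀ c : ℝ → ℝ, Measurable c →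
      ∀ᵐ p ∂limitMeasure, j • p.2.2 ≠ ((c p.1 : ℝ) : UnitAddCircle) := by
    intro j hj c hc
    have hm : MeasurableSet {p : ℝ × ℝ × UnitAddCircle |
        j • p.2.2 = ((c p.1 : ℝ) : UnitAddCircle)} :=
      measurableSet_eq_fun ((continuous_zsmul j).measurable.comp
        (measurable_snd.comp measurable_snd))
        (AddCircle.measurable_mk'.comp (hc.comp measurable_fst))
    have hm' : MeasurableSet {p : ℝ × ℝ × UnitAddCircle |
        j • p.2.2 ≠ ((c p.1 : ℝ) : UnitAddCircle)} := hm.compl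
    rw [limitMeasure, Measure.ae_prod_iff_ae_ae hm']
    refine Eventually.of_forall fun w => ?_
    have hz : ∀ᵐ z : UnitAddCircle, j • z ≠ ((c w : ℝ) : UnitAddCircle) :=
      measure_eq_zero_iff_ae_notMem.1 (volume_zsmul_eq hj _)
    exact Measure.quasiMeasurePreserving_snd.ae hz
  have hline' := ae_all_iff.2 fun j => (hline j 1).and (hline j (-1))
  have hz' : ∀ᵐ p ∂limitMeasure, ∀ j : ℤ, j ≠ 0 → j • p.2.2 ≠ 0 ∧
      j • p.2.2 ≠ ((lam * t / (2 * p.1) : ℝ) : UnitAddCircle) := by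
    rw [ae_all_iff]
    intro j
    by_cases hj : j = 0
    · exact Eventually.of_forall fun p h => (h hj).elim
    · filter_upwards [hz j hj (fun _ => 0) measurable_const,
        hz j hj (fun w => lam * t / (2 * w)) (by fun_prop)] with p h1 h2 _
      exact ⟨by simpa using h1, h2⟩
  filter_upwards [hw', hx', hline', hz'] with p h1 h2 h3 h4
  exact ⟨⟨h1, h2⟩, by simpa using h3, h4⟩

lemma exists_nat_mul_lt {t u : ℝ} (ht : 0 < t) (hu : 0 ≤ u) (hne : ∀ n : ℕ, (n : ℝ) * t ≠ u) :
    ∃ n : ℕ, (n : ℝ) * t < u ∧ u < (n + 1) * t := by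
  refine ⟨⌊u / t⌋₊, lt_of_le_of_ne ?_ (hne _), ?_⟩
  · rw [← le_div_iff₀ ht]; exact Nat.floor_le (by positivity)
  · rw [← div_lt_iff₀ ht]; exact Nat.lt_floor_add_one _

/-- The generic points of all the outer sets lie in one of the pieces. -/
lemma ae_mem_piece_of_mem_outerSet {t lam : ℝ} (ht : 0 < t) (hlam : 0 < lam) :
    ∀ᵐ p ∂limitMeasure, p ∈ ⋂ n : ℕ, outerSet t lam (1 / ((n : ℝ) + 1)) →
      p ∈ ⋃ q ∈ pairs t lam, piece t lam q.1 q.2 := by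
  filter_upwards [ae_generic t lam] with p hp hout
  obtain ⟨⟨⟨hw0, hw1, hwl⟩, hx⟩, hline, hz⟩ := hp
  have claim : ∀ j : ℤ, |p.2.1 * p.1 + j * t| < p.1 → ∀ q : ℝ, q * (2 * p.1) < lam * t →
      j • p.2.2 ∉ ((↑) : ℝ → UnitAddCircle) '' Set.Ioo 0 q := by
    intro j hj q hq hmem
    have h0 := tendsto_one_div_add_atTop_nhds_zero_nat (𝕜 := ℝ)
    have e1 := h0.eventually_lt_const hw0
    have e2 : ∀ᶠ n : ℕ in atTop, p.1 < 1 - 1 / ((n : ℝ) + 1) :=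
      (tendsto_const_nhds.sub h0).eventually_const_lt (by linarith)
    have e3 : ∀ᶠ n : ℕ in atTop, |p.2.1 * p.1 + j * t| < (1 - 1 / ((n : ℝ) + 1)) * p.1 :=
      ((tendsto_const_nhds.sub h0).mul_const _).eventually_const_lt (by linarith)
    have e4 : ∀ᶠ n : ℕ in atTop, q * (2 * p.1) < (lam - 1 / ((n : ℝ) + 1)) * t :=
      ((tendsto_const_nhds.sub h0).mul_const _).eventually_const_lt (by linarith)
    obtain ⟨n, h1, h2, h3, h4⟩ := (e1.and (e2.and (e3.and e4))).exists
    exact Set.mem_iInter.1 hout n ⟨h1, h2, j, h3, q, h4, hmem⟩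
  have hxw : |p.2.1 * p.1| < p.1 := by
    have h := hline 0
    simp only [Int.cast_zero, zero_mul, add_zero] at h
    have hle : |p.2.1 * p.1| ≤ p.1 := by
      rw [abs_mul, abs_of_pos hw0]; nlinarith
    obtain ⟨h1, h2⟩ := abs_le.1 hle
    exact abs_lt.2 ⟨lt_of_le_of_ne h1 h.2.symm, lt_of_le_of_ne h2 h.1⟩
  -- Row `j = 0`: otherwise `s = 1`, that is the left neighbour `(a - 1, b)` in the same row, would
  -- fall inside the gap.
  have hlt : lam * t / 2 < p.1 := by
    refine lt_of_le_of_ne ?_ hwl.symm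
    by_contra! hcon
    obtain ⟨q, hq1, hq2⟩ : ∃ q, 1 < q ∧ q < lam * t / (2 * p.1) :=
      exists_between (by rw [lt_div_iff₀ (by positivity)]; linarith)
    rw [lt_div_iff₀ (by positivity)] at hq2
    refine claim 0 (by simpa using hxw) q hq2 ⟨1, ⟨one_pos, hq1⟩, ?_⟩
    rw [zero_smul]
    exact AddCircle.coe_period 1
  obtain ⟨hx1, hx2⟩ := abs_lt.1 hxw
  obtain ⟨k, hk1, hk2⟩ := exists_nat_mul_lt (u := (p.2.1 + 1) * p.1) ht (by linarith) (by
    intro n hn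
    refine (hline (-n)).2 ?_
    push_cast; linarith)
  obtain ⟨r, hr1, hr2⟩ := exists_nat_mul_lt (u := (1 - p.2.1) * p.1) ht (by linarith) (by
    intro n hn
    refine (hline n).1 ?_
    push_cast; linarith)
  have hmem : p ∈ piece t lam k r := by
    refine ⟨⟨hlt, hw1⟩, ⟨hk1, hk2⟩, ⟨hr1, hr2⟩, ?_⟩
    intro j hjk hjr hj0
    refine ⟨(hz j hj0).1, claim j ?_⟩
    have h1 : -(k : ℝ) ≤ j := by exact_mod_cast hjk
    have h2 : (j : ℝ) ≤ r := by exact_mod_cast hjr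
    have h3 : -(k : ℝ) * t ≤ j * t := by gcongr
    have h4 : (j : ℝ) * t ≤ r * t := by gcongr
    rw [abs_lt]
    constructor <;> linarith
  exact Set.mem_biUnion (mem_pairs_of_mem_piece ht hlam hmem) hmem

/-- The generic points of the pieces lie in one of the inner sets. -/
lemma ae_mem_innerSet_of_mem_piece {t lam : ℝ} (ht : 0 < t) :
    ∀ᵐ p ∂limitMeasure, p ∈ ⋃ q ∈ pairs t lam, piece t lam q.1 q.2 →
      p ∈ ⋃ n : ℕ, innerSet t lam (1 / ((n : ℝ) + 1)) := by
  filter_upwards [ae_generic t lam] with p hp hin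
  obtain ⟨⟨⟨hw0, hw1, hwl⟩, hx⟩, hline, hz⟩ := hp
  obtain ⟨⟨k, r⟩, -, ⟨hlt, -⟩, ⟨hk1, hk2⟩, ⟨hr1, hr2⟩, hgood⟩ := Set.mem_iUnion₂.1 hin
  simp only at hk1 hk2 hr1 hr2 hgood
  have h0 := tendsto_one_div_add_atTop_nhds_zero_nat (𝕜 := ℝ)
  have e1 := h0.eventually_lt_const hw0
  have e2 : ∀ᶠ n : ℕ in atTop, (lam + 1 / ((n : ℝ) + 1)) * t / 2 < p.1 :=
    (((tendsto_const_nhds.add h0).mul_const _).div_const _).eventually_lt_const (by simpa using hlt)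
  have e3 : ∀ᶠ n : ℕ in atTop, ∀ j ∈ Finset.Icc (-⌈3 / t⌉) ⌈3 / t⌉, j ≠ 0 →
      |p.2.1 * p.1 + j * t| ≤ (1 + 1 / ((n : ℝ) + 1)) * p.1 →
      ∀ s : ℝ, 0 ≤ s → s * (2 * p.1) ≤ (lam + 1 / ((n : ℝ) + 1)) * t →
        j • p.2.2 ≠ (s : UnitAddCircle) := by
    -- The range of `j` is finite, so each `j` may be treated separately. Genericity makes the
    -- relevant inequality strict in both cases: a large fractional part for visible rows, `|xw +
    -- jt| > w` for the others.
    rw [eventually_all_finset]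
    intro j _
    by_cases hj0 : j = 0
    · exact Eventually.of_forall fun n h => (h hj0).elim
    by_cases hjkr : -(k : ℤ) ≤ j ∧ j ≤ r
    · obtain ⟨hg1, hg2⟩ := hgood j hjkr.1 hjkr.2 hj0
      obtain ⟨u, hu⟩ := QuotientAddGroup.mk_surjective (j • p.2.2)
      have hfu : ((Int.fract u : ℝ) : UnitAddCircle) = j • p.2.2 := by
        rw [← hu]
        exact coe_eq_coe_iff.2 ⟨-⌊u⌋, by push_cast; rw [Int.fract]; ring⟩
      have hf0 : 0 < Int.fract u := by
        refine lt_of_le_of_ne (Int.fract_nonneg u) fun h => hg1 ?_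
        rw [← hfu, ← h, AddCircle.coe_zero]
      have hfy : lam * t < Int.fract u * (2 * p.1) := by
        have hne := (hz j hj0).2
        by_contra! hcon
        rcases hcon.eq_or_lt with h | h
        · apply hne
          rw [← h, mul_div_assoc, div_self (by positivity), mul_one, hfu]
        · obtain ⟨q, hq1, hq2⟩ : ∃ q, Int.fract u < q ∧ q < lam * t / (2 * p.1) :=
            exists_between (by rwa [lt_div_iff₀ (by positivity)])
          rw [lt_div_iff₀ (by positivity)] at hq2
          exact hg2 q hq2 ⟨_, ⟨hf0, hq1⟩, hfu⟩
      have e4 : ∀ᶠ n : ℕ in atTop,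
          (lam + 1 / ((n : ℝ) + 1)) * t < Int.fract u * (2 * p.1) :=
        ((tendsto_const_nhds.add h0).mul_const _).eventually_lt_const (by simpa using hfy)
      filter_upwards [e4] with n hn _ _ s hs0 hs h
      have hsf : s < Int.fract u := lt_of_mul_lt_mul_right (hs.trans_lt hn) (by positivity)
      rw [← hfu, coe_eq_coe_iff] at h
      obtain ⟨m, hm⟩ := h
      have h1 : (0 : ℝ) < m := by linarith
      have h2 : (m : ℝ) < 1 := by linarith [Int.fract_lt_one u]
      have h3 : (0 : ℤ) < m := by exact_mod_cast h1
      have h4 : m < 1 := by exact_mod_cast h2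
      omega
    · have hgt : p.1 < |p.2.1 * p.1 + j * t| := by
        rw [lt_abs]
        by_cases hjk : -(k : ℤ) ≤ j
        · left
          have h1 : (r : ℤ) + 1 ≤ j := by
            by_contra hcon; exact hjkr ⟨hjk, by omega⟩
          have h2 : (r : ℝ) + 1 ≤ j := by exact_mod_cast h1
          have h3 : ((r : ℝ) + 1) * t ≤ j * t := by gcongr
          linarith
        · right
          have h1 : j ≤ -((k : ℤ) + 1) := by omega
          have h2 : (j : ℝ) ≤ -((k : ℝ) + 1) := by exact_mod_cast h1
          have h3 : (j : ℝ) * t ≤ -((k : ℝ) + 1) * t := by gcongr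
          linarith
      have e4 : ∀ᶠ n : ℕ in atTop,
          (1 + 1 / ((n : ℝ) + 1)) * p.1 < |p.2.1 * p.1 + j * t| :=
        ((tendsto_const_nhds.add h0).mul_const _).eventually_lt_const (by simpa using hgt)
      filter_upwards [e4] with n hn _ hle
      exact absurd hle (not_le.2 hn)
  obtain ⟨n, h1, h2, h3⟩ := (e1.and (e2.and e3)).exists
  exact Set.mem_iUnion.2 ⟨n, h1, h2, h3⟩

lemma outerSet_mono (t lam : ℝ) {ε ε' : ℝ} (ht : 0 < t) (hε : 0 ≤ ε) (h : ε ≤ ε') :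
    outerSet t lam ε ⊆ outerSet t lam ε' := by
  rintro p hp ⟨h1, h2, j, hj, q, hq, hm⟩
  have hw : 0 ≤ p.1 := (hε.trans h).trans h1.le
  refine hp ⟨by linarith, by linarith, j, hj.trans_le (by gcongr), q, hq.trans_le (by gcongr), hm⟩

lemma innerSet_anti (t lam : ℝ) {ε ε' : ℝ} (ht : 0 < t) (hε : 0 ≤ ε) (h : ε ≤ ε') :
    innerSet t lam ε' ⊆ innerSet t lam ε := by
  rintro p ⟨h1, h2, h3⟩
  have hw : 0 ≤ p.1 := (hε.trans h).trans h1.le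
  refine ⟨by linarith, lt_of_le_of_lt (by gcongr) h2, fun j hj hj0 hle s hs0 hs => ?_⟩
  exact h3 j hj hj0 (hle.trans (by gcongr)) s hs0 (hs.trans (by gcongr))

/-! ### The measure of a piece as an integral -/

/-- Averaging a periodic set over translates of an interval. -/
lemma lintegral_volume_Icc_inter_preimage (a b : ℝ) {B : Set UnitAddCircle}
    (hB : MeasurableSet B) :
    ∫⁻ x in Set.Ioc (0 : ℝ) 1, volume (Set.Icc (a + x) (b + x) ∩
      ((↑) : ℝ → UnitAddCircle) ⁻¹' B) = ENNReal.ofReal (b - a) * volume B := by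
  set C : Set ℝ := ((↑) : ℝ → UnitAddCircle) ⁻¹' B with hCdef
  have hC : MeasurableSet C := AddCircle.measurable_mk' hB
  have h1 : ∀ x : ℝ, volume (Set.Icc (a + x) (b + x) ∩ C) =
      ∫⁻ u in Set.Icc a b, C.indicator 1 (u + x) := by
    intro x
    have e1 : (fun u => u + x) ⁻¹' (Set.Icc (a + x) (b + x) ∩ C) =
        (fun u => u + x) ⁻¹' C ∩ Set.Icc a b := by
      ext u; simp [and_comm]
    rw [← measure_preimage_add_right volume x, e1,
      ← Measure.restrict_apply ((measurable_add_const x) hC),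
      ← lintegral_indicator_one ((measurable_add_const x) hC)]
    rfl
  have h2 : ∀ u : ℝ, ∫⁻ x in Set.Ioc (0 : ℝ) 1, C.indicator (1 : ℝ → ℝ≥0∞) (u + x) =
      volume B := by
    intro u
    have e1 : (fun x => u + x) ⁻¹' (C ∩ Set.Ioc u (u + 1)) =
        (fun x => u + x) ⁻¹' C ∩ Set.Ioc (0 : ℝ) 1 := by
      ext x; simp
    have e2 : volume B = volume (C ∩ Set.Ioc u (u + 1)) := by
      rw [← (UnitAddCircle.measurePreserving_mk u).measure_preimage hB.nullMeasurableSet,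
        Measure.restrict_apply hC]
    rw [e2, ← measure_preimage_add volume u, e1,
      ← Measure.restrict_apply ((measurable_const_add u) hC),
      ← lintegral_indicator_one ((measurable_const_add u) hC)]
    rfl
  simp only [h1]
  -- After the swap, the inner integral runs over a full period starting at `u`, so it does not
  -- depend on `u`.
  rw [lintegral_lintegral_swap]
  · simp only [h2]
    rw [setLIntegral_const, Real.volume_Icc, mul_comm]
  · have : Measurable (C.indicator (1 : ℝ → ℝ≥0∞)) := measurable_one.indicator hC
    exact (this.comp (measurable_snd.add measurable_fst)).aemeasurable

/-- A fractional part is at least `y` exactly when the class avoids 0 and every arc `(0, q)` with `q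
< y`. This separates the interval, which moves with `x`, from a fixed periodic set. -/
lemma A_eq_inter_goodPhase {t lam : ℝ} (k r : ℕ) {w : ℝ} (hw : 0 < w) (hlam : 0 < lam * t) (x : ℝ) :
    A t lam k r w x = Set.Icc (R t k r w + x) (S t k r w + x) ∩
      ((↑) : ℝ → UnitAddCircle) ⁻¹' goodPhase t lam k r w := by
  ext z
  rw [A, Set.mem_ofPred_eq, Set.mem_inter_iff, Set.mem_preimage]
  refine and_congr_right fun _ => forall_congr' fun j => forall_congr' fun _ =>
    forall_congr' fun _ => forall_congr' fun _ => ?_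
  have hfu : ((Int.fract ((j : ℝ) * z) : ℝ) : UnitAddCircle) = j • (z : UnitAddCircle) := by
    rw [← AddCircle.coe_zsmul]
    exact coe_eq_coe_iff.2 ⟨-⌊(j : ℝ) * z⌋, by push_cast; rw [Int.fract, zsmul_eq_mul]; ring⟩
  have hf0 := Int.fract_nonneg ((j : ℝ) * z)
  have hf1 := Int.fract_lt_one ((j : ℝ) * z)
  have hy : 0 < y t lam w := by unfold y; positivity
  rw [← hfu]
  constructor
  · intro h
    have key : ∀ s : ℝ, 0 ≤ s → s < y t lam w →
        ((Int.fract ((j : ℝ) * z) : ℝ) : UnitAddCircle) ≠ (s : UnitAddCircle) := by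
      intro s hs0 hs heq
      obtain ⟨m, hm⟩ := coe_eq_coe_iff.1 heq
      have h1 : (0 : ℝ) < m := by linarith
      have h2 : (m : ℝ) < 1 := by linarith
      have h3 : (0 : ℤ) < m := by exact_mod_cast h1
      have h4 : m < 1 := by exact_mod_cast h2
      omega
    refine ⟨by simpa using key 0 le_rfl hy, ?_⟩
    rintro q hq ⟨s, hs, heq⟩
    refine key s hs.1.le ?_ heq.symm
    have : s < q := hs.2
    rw [y, lt_div_iff₀ (by positivity)]
    refine lt_trans ?_ hq
    gcongr
  · rintro ⟨h1, h2⟩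
    by_contra! hcon
    have hf0' : 0 < Int.fract ((j : ℝ) * z) := lt_of_le_of_ne hf0 fun h => h1 (by rw [← h]; simp)
    obtain ⟨q, hq1, hq2⟩ := exists_between hcon
    rw [y, lt_div_iff₀ (by positivity)] at hq2
    exact h2 q hq2 ⟨_, ⟨hf0', hq1⟩, rfl⟩

lemma integral_volume_A {t lam : ℝ} (k r : ℕ) {w : ℝ} (hw : 0 < w) (hlam : 0 < lam * t) :
    ∫ x in (0 : ℝ)..1, w * volume.real (A t lam k r w x) =
      (ENNReal.ofReal (w * (S t k r w - R t k r w)) * volume (goodPhase t lam k r w)).toReal := by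
  have hB := measurableSet_goodPhase t lam k r w
  set B := goodPhase t lam k r w
  have hA : ∀ x, A t lam k r w x = Set.Icc (R t k r w + x) (S t k r w + x) ∩
      ((↑) : ℝ → UnitAddCircle) ⁻¹' B := A_eq_inter_goodPhase k r hw hlam
  have hmeas : Measurable fun x : ℝ => volume (Set.Icc (R t k r w + x) (S t k r w + x) ∩
      ((↑) : ℝ → UnitAddCircle) ⁻¹' B) := by
    have hs : MeasurableSet {p : ℝ × ℝ | p.2 ∈ Set.Icc (R t k r w + p.1) (S t k r w + p.1) ∩
        ((↑) : ℝ → UnitAddCircle) ⁻¹' B} := by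
      have h1 : MeasurableSet {p : ℝ × ℝ | R t k r w + p.1 ≤ p.2} :=
        (isClosed_le (by fun_prop) (by fun_prop)).measurableSet
      have h2 : MeasurableSet {p : ℝ × ℝ | p.2 ≤ S t k r w + p.1} :=
        (isClosed_le (by fun_prop) (by fun_prop)).measurableSet
      exact (h1.inter h2).inter (measurable_snd (AddCircle.measurable_mk' hB))
    exact measurable_measure_prodMk_left hs
  rw [intervalIntegral.integral_const_mul, intervalIntegral.integral_of_le zero_le_one]
  simp only [hA, Measure.real]
  rw [integral_toReal hmeas.aemeasurable, lintegral_volume_Icc_inter_preimage _ _ hB,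
    ENNReal.ofReal_mul hw.le, ENNReal.toReal_mul, ENNReal.toReal_mul, ENNReal.toReal_mul,
    ENNReal.toReal_ofReal hw.le, mul_assoc]
  exact Eventually.of_forall fun x => (measure_mono Set.inter_subset_left).trans_lt
    (by rw [Real.volume_Icc]; exact ENNReal.ofReal_lt_top)

/-- The origin of `R` and `S`: multiplied by `w`, they are the endpoints of the interval of `x` for
which exactly the rows `-k, …, r` are visible. -/
lemma mem_Ioo_mul_R_S {t : ℝ} (k r : ℕ) {w : ℝ} (hw : 0 < w) (x : ℝ) :
    x ∈ Set.Ioo (w * R t k r w) (w * S t k r w) ↔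
      (k * t < (x + 1) * w ∧ (x + 1) * w < (k + 1) * t) ∧
      (r * t < (1 - x) * w ∧ (1 - x) * w < (r + 1) * t) := by
  have hw2 : 0 < w ^ 2 := by positivity
  have e1 : ∀ c : ℝ, c / w ^ 2 - 1 / w = (c - w) / w ^ 2 := by intro c; field_simp
  have e2 : ∀ c : ℝ, 1 / w - c / w ^ 2 = (w - c) / w ^ 2 := by intro c; field_simp
  have e3 : x / w = (x * w) / w ^ 2 := by field_simp
  rw [Set.mem_Ioo, ← lt_div_iff₀' hw, ← div_lt_iff₀' hw, R, S, max_lt_iff, lt_min_iff, e1, e1, e2,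
    e2, e3]
  simp only [div_lt_div_iff_of_pos_right hw2]
  constructor
  · rintro ⟨⟨h1, h2⟩, h3, h4⟩
    refine ⟨⟨?_, ?_⟩, ?_, ?_⟩ <;> linarith
  · rintro ⟨⟨h1, h2⟩, h3, h4⟩
    refine ⟨⟨?_, ?_⟩, ?_, ?_⟩ <;> linarith

lemma limitMeasure_piece {t lam : ℝ} (ht : 0 < t) (hlam : 0 < lam) (k r : ℕ) :
    limitMeasure (piece t lam k r) = 2⁻¹ * ∫⁻ w in Set.Ioo (lam * t / 2) 1,
      ENNReal.ofReal (w * (S t k r w - R t k r w)) * volume (goodPhase t lam k r w) := by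
  rw [limitMeasure, Measure.prod_apply (measurableSet_piece t lam k r),
    ← lintegral_const_mul' _ _ (by simp)]
  have hsub : Set.Ioo (lam * t / 2) 1 ∩ Set.Icc 0 1 = Set.Ioo (lam * t / 2) 1 := by
    refine Set.inter_eq_left.2 fun w hw => ⟨le_trans (by positivity) hw.1.le, hw.2.le⟩
  conv_rhs => rw [← hsub, ← Measure.restrict_restrict measurableSet_Ioo,
    ← lintegral_indicator measurableSet_Ioo]
  refine lintegral_congr fun w => ?_
  by_cases hw : w ∈ Set.Ioo (lam * t / 2) 1
  · have hw0 : 0 < w := lt_trans (by positivity) hw.1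
    have hslice : Prod.mk w ⁻¹' piece t lam k r =
        Set.Ioo (w * R t k r w) (w * S t k r w) ×ˢ goodPhase t lam k r w := by
      ext p
      rw [Set.mem_prod, mem_Ioo_mul_R_S k r hw0]
      simp only [piece, Set.mem_preimage, Set.mem_ofPred_eq]
      constructor
      · rintro ⟨-, h1, h2, h3⟩; exact ⟨⟨h1, h2⟩, h3⟩
      · rintro ⟨⟨h1, h2⟩, h3⟩; exact ⟨hw, h1, h2, h3⟩
    have hI : Set.Ioo (w * R t k r w) (w * S t k r w) ⊆ Set.Icc (-1) 1 := by
      intro x hx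
      rw [mem_Ioo_mul_R_S k r hw0] at hx
      obtain ⟨⟨h1, -⟩, h2, -⟩ := hx
      have h3 : 0 < (x + 1) * w := lt_of_le_of_lt (by positivity) h1
      have h4 : 0 < (1 - x) * w := lt_of_le_of_lt (by positivity) h2
      have h5 := pos_of_mul_pos_left h3 hw0.le
      have h6 := pos_of_mul_pos_left h4 hw0.le
      exact ⟨by linarith, by linarith⟩
    rw [Set.indicator_of_mem hw, hslice, Measure.prod_prod, Measure.smul_apply,
      Measure.restrict_apply measurableSet_Ioo, Set.inter_eq_left.2 hI, Real.volume_Ioo,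
      ← mul_sub, smul_eq_mul, mul_assoc]
  · rw [Set.indicator_of_notMem hw]
    have : Prod.mk w ⁻¹' piece t lam k r = ∅ := by
      refine Set.eq_empty_of_forall_notMem fun p hp => hw ⟨hp.1.1, hp.1.2⟩
    rw [this, measure_empty]

/-- Any `x` in a nonempty slice would give `(k + r)t < 2w < (k + r + 2)t`. Hence nothing is lost
when the range of `w` is cut down to `[M⁻, M⁺]`. -/
lemma S_le_R_of_le {t : ℝ} (k r : ℕ) {w : ℝ} (hw : 0 < w)
    (h : w ≤ (k + r) * t / 2 ∨ (k + r + 2) * t / 2 ≤ w) :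
    w * (S t k r w - R t k r w) ≤ 0 := by
  by_contra! hcon
  rw [mul_sub, sub_pos] at hcon
  obtain ⟨x, hx⟩ := exists_between hcon
  obtain ⟨⟨h1, h2⟩, h3, h4⟩ := (mem_Ioo_mul_R_S k r hw x).1 hx
  rcases h with h | h <;> linarith

lemma integral_piece {t lam : ℝ} (ht : 0 < t) (hlam : 0 < lam) {k r : ℕ}
    (hM : Mminus t lam k r ≤ Mplus t k r) :
    ∫ w in (Mminus t lam k r)..(Mplus t k r),
      ∫ x in (0 : ℝ)..1, w * volume.real (A t lam k r w x) =
      2 * limitMeasure.real (piece t lam k r) := by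
  have hlt : 0 < lam * t := by positivity
  set f : ℝ → ℝ≥0∞ := fun w =>
    ENNReal.ofReal (w * (S t k r w - R t k r w)) * volume (goodPhase t lam k r w) with hf
  have hfm : Measurable f := by
    refine Measurable.mul ?_ (measurable_measure_prodMk_left (measurableSet_goodPhase_prod t lam k r))
    unfold S R
    fun_prop
  have hmem : ∀ w, w ∈ Set.Ioo (Mminus t lam k r) (Mplus t k r) ↔
      w ∈ Set.Ioo (lam * t / 2) 1 ∧ (k + r) * t / 2 < w ∧ w < (k + r + 2) * t / 2 := by
    intro w
    rw [Set.mem_Ioo, Set.mem_Ioo, Mminus, Mplus, max_lt_iff, lt_min_iff]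
    tauto
  have h1 : ∫⁻ w in Set.Ioo (lam * t / 2) 1, f w =
      ∫⁻ w in Set.Ioo (Mminus t lam k r) (Mplus t k r), f w := by
    rw [← lintegral_indicator measurableSet_Ioo, ← lintegral_indicator measurableSet_Ioo]
    refine lintegral_congr fun w => ?_
    by_cases hw : w ∈ Set.Ioo (Mminus t lam k r) (Mplus t k r)
    · rw [Set.indicator_of_mem hw, Set.indicator_of_mem ((hmem w).1 hw).1]
    · rw [Set.indicator_of_notMem hw]
      by_cases hw' : w ∈ Set.Ioo (lam * t / 2) 1
      · rw [Set.indicator_of_mem hw', hf]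
        have hw0 : 0 < w := lt_trans (by positivity) hw'.1
        have : w * (S t k r w - R t k r w) ≤ 0 := by
          refine S_le_R_of_le k r hw0 ?_
          by_contra! hcon
          exact hw ((hmem w).2 ⟨hw', hcon⟩)
        simp only [ENNReal.ofReal_of_nonpos this, zero_mul]
      · rw [Set.indicator_of_notMem hw']
  rw [Measure.real, limitMeasure_piece ht hlam, h1, intervalIntegral.integral_of_le hM,
    integral_Ioc_eq_integral_Ioo]
  have h2 : ∫ w in Set.Ioo (Mminus t lam k r) (Mplus t k r),
      ∫ x in (0 : ℝ)..1, w * volume.real (A t lam k r w x) =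
      ∫ w in Set.Ioo (Mminus t lam k r) (Mplus t k r), (f w).toReal := by
    refine setIntegral_congr_fun measurableSet_Ioo fun w hw => ?_
    exact integral_volume_A k r (lt_trans (by positivity) ((hmem w).1 hw).1.1) hlt
  rw [h2, integral_toReal hfm.aemeasurable, ENNReal.toReal_mul, ENNReal.toReal_inv,
    ENNReal.toReal_ofNat]
  · ring
  · refine Eventually.of_forall fun w => ENNReal.mul_lt_top ENNReal.ofReal_lt_top ?_
    exact measure_lt_top _ _

lemma limitMeasure_biUnion_piece {t lam : ℝ} (ht : 0 < t) (hlam : 0 < lam) :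
    limitMeasure.real (⋃ p ∈ pairs t lam, piece t lam p.1 p.2) =
      (1 / 2 : ℝ) * ∑ p ∈ pairs t lam, ∫ w in (Mminus t lam p.1 p.2)..(Mplus t p.1 p.2),
        ∫ x in (0 : ℝ)..1, w * volume.real (A t lam p.1 p.2 w x) := by
  rw [measureReal_biUnion_finset (fun p _ q _ h => pairwise_disjoint_piece ht lam h)
    (fun p _ => measurableSet_piece t lam p.1 p.2), Finset.mul_sum]
  refine Finset.sum_congr rfl fun p hp => ?_
  rw [integral_piece ht hlam (Finset.mem_filter.1 hp).2]
  ring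

/-! ### Squeezing the gap distribution -/

lemma eventually_gapDist_le {t lam : ℝ} (ht : 0 < t) (hlam : 0 < lam) {ε : ℝ} (hε : 0 < ε) :
    ∀ᶠ J in atTop, gapDist t J lam ≤ (empirical t J).real (outerSet t lam ε) := by
  classical
  filter_upwards [eventually_mem_outerSet ht lam hlam hε,
    (tendsto_mul_avgGap ht).eventually_const_lt one_pos, eventually_two_lt_mul ht] with J hJ hpos hJ2
  have hJ' : (0 : ℝ) < J := by exact_mod_cast hJ2.1
  have hgap : 0 < lam * avgGap t J :=
    mul_pos hlam (pos_of_mul_pos_right hpos (by positivity))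
  rw [empirical_real_apply t J (isClosed_outerSet t lam ε).measurableSet, gapDist]
  refine div_le_div_of_nonneg_right ?_ (Nat.cast_nonneg _)
  have h1 := card_gaps_le (rect J) (viewAngle t J) hgap
  refine Nat.cast_le.2 (le_trans (le_of_eq ?_) (h1.trans (Finset.card_le_card ?_)))
  · congr 1
  · intro P hP
    rw [Finset.mem_filter] at hP ⊢
    exact ⟨hP.1, hJ P hP.1 hP.2⟩

lemma eventually_le_gapDist {t lam : ℝ} (ht : 0 < t) (hlam : 0 < lam) {ε : ℝ} (hε : 0 < ε)
    (hε1 : ε ≤ 1) :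
    ∀ᶠ J in atTop, (empirical t J).real (innerSet t lam ε) - 1 / (numPts J : ℝ) ≤
      gapDist t J lam := by
  classical
  filter_upwards [eventually_of_mem_innerSet ht lam hlam hε hε1] with J hJ
  rw [empirical_real_apply t J (isOpen_innerSet t lam hε).measurableSet, gapDist, ← sub_div]
  refine div_le_div_of_nonneg_right ?_ (Nat.cast_nonneg _)
  rw [sub_le_iff_le_add]
  have h1 := le_card_gaps_add_one (rect J) (viewAngle t J) (lam * avgGap t J)
  refine le_trans (Nat.cast_le.2 (le_trans (Finset.card_le_card fun P hP => ?_) h1))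
    (le_of_eq ?_)
  · rw [Finset.mem_filter] at hP ⊢
    exact ⟨hP.1, hJ P hP.1 hP.2⟩
  · rw [Nat.cast_add, Nat.cast_one]
    congr 1

lemma tendsto_one_div_numPts : Tendsto (fun J => 1 / (numPts J : ℝ)) atTop (𝓝 0) := by
  refine squeeze_zero (fun J => by positivity) (fun J => ?_)
    (tendsto_one_div_add_atTop_nhds_zero_nat (𝕜 := ℝ))
  rw [numPts_eq]
  push_cast
  gcongr
  nlinarith [(Nat.cast_nonneg J : (0 : ℝ) ≤ J)]

lemma eventually_empirical_lt {t : ℝ} (ht : 0 < t) {F : Set (ℝ × ℝ × UnitAddCircle)}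
    (hF : IsClosed F) {c : ℝ} (hc : limitMeasure.real F < c) :
    ∀ᶠ J in atTop, (empirical t J).real F < c := by
  have h := ProbabilityMeasure.limsup_measure_closed_le_of_tendsto (tendsto_empiricalProb ht) hF
  have h1 : limitMeasure F < ENNReal.ofReal c :=
    (ENNReal.lt_ofReal_iff_toReal_lt (measure_ne_top _ _)).2 hc
  filter_upwards [eventually_lt_of_limsup_lt (h.trans_lt h1)] with J hJ
  exact ENNReal.toReal_lt_of_lt_ofReal hJ

lemma eventually_lt_empirical {t : ℝ} (ht : 0 < t) {G : Set (ℝ × ℝ × UnitAddCircle)}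
    (hG : IsOpen G) {c : ℝ} (hc0 : 0 ≤ c) (hc : c < limitMeasure.real G) :
    ∀ᶠ J in atTop, c < (empirical t J).real G := by
  have h := ProbabilityMeasure.le_liminf_measure_open_of_tendsto (tendsto_empiricalProb ht) hG
  have h1 : ENNReal.ofReal c < limitMeasure G :=
    (ENNReal.ofReal_lt_iff_lt_toReal hc0 (measure_ne_top _ _)).2 hc
  filter_upwards [eventually_lt_of_lt_liminf (h1.trans_le h)] with J hJ
  exact (ENNReal.ofReal_lt_iff_lt_toReal hc0 (measure_ne_top (empirical t J) _)).1 hJ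

/-- Portmanteau bounds hold at each fixed `ε = 1/(n + 1)`; monotone continuity of the limit measure
then lets `n → ∞`. Up to null sets the intersection of the outer sets lies in the union of the
pieces, which lies in the union of the inner sets, so the two bounds meet. -/
lemma tendsto_gapDist {t lam : ℝ} (ht : 0 < t) (hlam : 0 < lam) :
    Tendsto (fun J => gapDist t J lam) atTop
      (𝓝 (limitMeasure.real (⋃ p ∈ pairs t lam, piece t lam p.1 p.2))) := by
  have hpos : ∀ n : ℕ, 0 < 1 / ((n : ℝ) + 1) := fun n => by positivity
  have hmono : ∀ {m n : ℕ}, m ≤ n → 1 / ((n : ℝ) + 1) ≤ 1 / ((m : ℝ) + 1) := fun h => by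
    gcongr
  rw [tendsto_order]
  constructor
  · intro c hc
    rcases lt_or_ge c 0 with hc0 | hc0
    · exact Eventually.of_forall fun J => hc0.trans_le (by unfold gapDist; positivity)
    have h1 : Tendsto (fun n : ℕ => limitMeasure.real (innerSet t lam (1 / ((n : ℝ) + 1)))) atTop
        (𝓝 (limitMeasure.real (⋃ n : ℕ, innerSet t lam (1 / ((n : ℝ) + 1))))) :=
      (ENNReal.tendsto_toReal (measure_ne_top _ _)).comp (tendsto_measure_iUnion_atTop
        fun m n h => innerSet_anti t lam ht (hpos n).le (hmono h))
    have h2 : limitMeasure (⋃ p ∈ pairs t lam, piece t lam p.1 p.2) ≤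
        limitMeasure (⋃ n : ℕ, innerSet t lam (1 / ((n : ℝ) + 1))) :=
      measure_mono_ae (ae_mem_innerSet_of_mem_piece ht)
    have h3 := hc.trans_le (ENNReal.toReal_mono (measure_ne_top _ _) h2)
    obtain ⟨n, hn⟩ := (h1.eventually_const_lt h3).exists
    -- The room between `c` and `c'` absorbs the term `1/N_J` that comes from the last point, which
    -- no gap follows.
    obtain ⟨c', hcc', hc'⟩ := exists_between hn
    have hn1 : 1 / ((n : ℝ) + 1) ≤ 1 := by simpa using hmono (Nat.zero_le n)
    filter_upwards [eventually_le_gapDist ht hlam (hpos n) hn1,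
      eventually_lt_empirical ht (isOpen_innerSet t lam (hpos n)) (hc0.trans hcc'.le) hc',
      tendsto_one_div_numPts.eventually_lt_const (sub_pos.2 hcc')] with J hJ1 hJ2 hJ3
    linarith
  · intro c hc
    have h1 : Tendsto (fun n : ℕ => limitMeasure.real (outerSet t lam (1 / ((n : ℝ) + 1)))) atTop
        (𝓝 (limitMeasure.real (⋂ n : ℕ, outerSet t lam (1 / ((n : ℝ) + 1))))) :=
      (ENNReal.tendsto_toReal (measure_ne_top _ _)).comp (tendsto_measure_iInter_atTop
        (fun n => (isClosed_outerSet t lam _).measurableSet.nullMeasurableSet)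
        (fun m n h => outerSet_mono t lam ht (hpos n).le (hmono h)) ⟨0, measure_ne_top _ _⟩)
    have h2 : limitMeasure (⋂ n : ℕ, outerSet t lam (1 / ((n : ℝ) + 1))) ≤
        limitMeasure (⋃ p ∈ pairs t lam, piece t lam p.1 p.2) :=
      measure_mono_ae (ae_mem_piece_of_mem_outerSet ht hlam)
    have h3 := (ENNReal.toReal_mono (measure_ne_top _ _) h2).trans_lt hc
    obtain ⟨n, hn⟩ := (h1.eventually_lt_const h3).exists
    filter_upwards [eventually_gapDist_le ht hlam (hpos n),
      eventually_empirical_lt ht (isClosed_outerSet t lam _) hn] with J hJ1 hJ2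
    exact hJ1.trans_lt hJ2

end MovingObserver

end

theorem theorem2 (t : ℝ) (ht : 0 < t) (lam : ℝ) (hlam : 0 < lam) :
    Filter.Tendsto (fun J : ℕ => MovingObserver.gapDist t J lam) Filter.atTop
      (𝓝 ((1 / 2 : ℝ) * ∑ p ∈ MovingObserver.pairs t lam,
        ∫ w in (MovingObserver.Mminus t lam p.1 p.2)..(MovingObserver.Mplus t p.1 p.2),
          ∫ x in (0 : ℝ)..1,
            w * MeasureTheory.volume.real (MovingObserver.A t lam p.1 p.2 w x))) := by
  rw [← MovingObserver.limitMeasure_biUnion_piece ht hlam]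
  exact MovingObserver.tendsto_gapDist ht hlam
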